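/- Let $D$ be an integral domain with quotient field $K$. For a nonzero fractional ideal $A$ of $D$ put $A^{-1}=\{x\in K\mid xA\subseteq D\}$, $A_v=(A^{-1})^{-1}$ and $A_t=\bigcup\{J_v\mid J\subseteq A$ a nonzero finitely generated fractional ideal$\}$. A *fractional $t$-ideal* is a nonzero fractional ideal $A$ with $A_t=A$; it is a *$t$-ideal* if moreover $A\subseteq D$. A *maximal $t$-ideal* is a $t$-ideal that is maximal among the proper $t$-ideals. $A$ is *$t$-invertible* if $(AA^{-1})_t=D$. The *$t$-class group* ${\rm Cl}_t(D)$ is the group of $t$-invertible fractional $t$-ideals under $(I,J)\mapsto (IJ)_t$ modulo the subgroup of nonzero principal fractional ideals. An ideal $I$ of $D$ is a *valuation ideal* if $IV\cap D=I$ for some valuation ring $V$ with $D\subseteq V\subseteq K$ and quotient field $K$ (the case $V=K$ is allowed). A *valuation element* is a nonzero nonunit $a\in D$ such that $aD$ is a valuation ideal. The domain $D$ is called - an *AVFD* if for every nonzero nonunit $a\in D$ some power $a^n$ with $n\ge 1$ is a finite product of valuation elements; - a *$t$-VIFD* if every nonzero principal ideal of $D$ is of the form $(I_1\cdots I_n)_t$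 with $n\ge 1$ and valuation ideals $I_1,\dots,I_n$ of $D$; - *weakly Matlis* if every nonzero nonunit lies in only finitely many maximal $t$-ideals and every nonzero prime $t$-ideal is contained in a unique maximal $t$-ideal; - a *P$v$MD* if every nonzero finitely generated ideal of $D$ is $t$-invertible, and an *independent ring of Krull type* if it is a weakly Matlis P$v$MD; - an *AGCD domain* if for all $a,b\in D$ there is $n\ge 1$ such that $a^nD\cap b^nD$ is principal; - *$t$-treed* if any two prime $t$-ideals of $D$ that are contained in a common prime $t$-ideal are comparable under inclusion. Let $D$ be a $t$-treed domain. Then the following statements are equivalent. 1. $D$ is an AVFD. 2. $D$ is an integrally closed weakly Matlis AGCD domain. 3. $D$ is an independent ring of Krull type and ${\rm Cl}_t(D)$ is a torsion group. 4. ${\rm Cl}_t(D)$ is a torsion group and each nonzero prime ideal of $D$ contains a valuation element. 5. $D$ is a $t$-VIFD and ${\rm Cl}_t(D)$ is a torsion group. 6. The polynomial ring $D[X]$ is an AVFD. -/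

import Mathlib

open scoped nonZeroDivisors Polynomial

noncomputable section

section

variable {D : Type*} [CommRing D] [IsDomain D] {K : Type*} [Field K] [Algebra D K]
  [IsFractionRing D K]

/-- The `v`-operation `I ↦ (I⁻¹)⁻¹` on fractional ideals of the domain `D` with quotient field `K`.
Mathlib's `FractionalIdeal D⁰ K` also contains the zero ideal, for which `0⁻¹ = 0`. -/
def vClosure (I : FractionalIdeal D⁰ K) : FractionalIdeal D⁰ K := (I⁻¹)⁻¹

theorem le_vClosure (I : FractionalIdeal D⁰ K) : I ≤ vClosure I := by
  by_cases h : I⁻¹ = 0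
  · by_cases hI : I = 0
    · rw [hI]; exact bot_le
    · exfalso
      rw [FractionalIdeal.inv_eq] at h
      obtain ⟨a, aI, ha, h'⟩ := FractionalIdeal.exists_eq_spanSingleton_mul I
      have : algebraMap D K a ∈ (1 / I : FractionalIdeal D⁰ K) := by
        rw [FractionalIdeal.mem_div_iff_of_ne_zero hI]
        intro y hy
        rw [h', FractionalIdeal.mem_singleton_mul] at hy
        obtain ⟨z, hz, rfl⟩ := hy
        have ha' : algebraMap D K a ≠ 0 := by simpa using ha
        rw [mul_inv_cancel_left₀ ha']
        exact FractionalIdeal.coeIdeal_le_one hz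
      rw [h, FractionalIdeal.mem_zero_iff] at this
      exact ha (by simpa using this)
  · rw [vClosure, FractionalIdeal.inv_eq (I := I⁻¹), FractionalIdeal.le_div_iff_mul_le h]
    exact FractionalIdeal.mul_one_div_le_one

theorem inv_ne_zero_of_ne_zero {I : FractionalIdeal D⁰ K} (hI : I ≠ 0) : I⁻¹ ≠ 0 := by
  intro h
  have := le_vClosure I
  rw [vClosure, h, FractionalIdeal.inv_zero'] at this
  exact hI (le_antisymm this bot_le)

theorem vClosure_mono {I J : FractionalIdeal D⁰ K} (h : I ≤ J) : vClosure I ≤ vClosure J := by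
  by_cases hI : I = 0
  · rw [hI, vClosure, FractionalIdeal.inv_zero', FractionalIdeal.inv_zero']; exact bot_le
  · have hJ : J ≠ 0 := fun hJ => hI (le_antisymm (hJ ▸ h) bot_le)
    exact FractionalIdeal.inv_anti_mono (inv_ne_zero_of_ne_zero hJ) (inv_ne_zero_of_ne_zero hI)
      (FractionalIdeal.inv_anti_mono hI hJ h)

theorem vClosure_inv (I : FractionalIdeal D⁰ K) : vClosure I⁻¹ = I⁻¹ := by
  refine le_antisymm ?_ (le_vClosure _)
  by_cases hI : I = 0
  · rw [hI, vClosure, FractionalIdeal.inv_zero', FractionalIdeal.inv_zero', FractionalIdeal.inv_zero']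
  · exact FractionalIdeal.inv_anti_mono hI
      (inv_ne_zero_of_ne_zero (inv_ne_zero_of_ne_zero hI)) (le_vClosure I)

theorem vClosure_vClosure (I : FractionalIdeal D⁰ K) : vClosure (vClosure I) = vClosure I :=
  vClosure_inv _

/-- The `t`-operation: `I_t` is the union of the `J_v`, where `J` runs through the finitely
generated fractional ideals contained in `I`. -/
def tClosure (I : FractionalIdeal D⁰ K) : FractionalIdeal D⁰ K :=
  ⟨{ carrier := {x | ∃ J : FractionalIdeal D⁰ K, (J : Submodule D K).FG ∧ J ≤ I ∧ x ∈ vClosure J}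
     zero_mem' := ⟨0, by simpa using Submodule.fg_bot, bot_le, Submodule.zero_mem _⟩
     add_mem' := by
       rintro x y ⟨J, hJ, hJI, hx⟩ ⟨L, hL, hLI, hy⟩
       refine ⟨J ⊔ L, ?_, sup_le hJI hLI, ?_⟩
       · rw [FractionalIdeal.coe_sup]; exact hJ.sup hL
       · exact Submodule.add_mem _ (vClosure_mono le_sup_left hx) (vClosure_mono le_sup_right hy)
     smul_mem' := by
       rintro c x ⟨J, hJ, hJI, hx⟩
       exact ⟨J, hJ, hJI, Submodule.smul_mem _ c hx⟩ },
    by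
      obtain ⟨a, ha, h⟩ := (vClosure I).isFractional
      exact ⟨a, ha, fun x ⟨J, _, hJI, hx⟩ => h x (vClosure_mono hJI hx)⟩⟩

theorem mem_tClosure {I : FractionalIdeal D⁰ K} {x : K} :
    x ∈ tClosure I ↔
      ∃ J : FractionalIdeal D⁰ K, (J : Submodule D K).FG ∧ J ≤ I ∧ x ∈ vClosure J := Iff.rfl

theorem tClosure_le_vClosure (I : FractionalIdeal D⁰ K) : tClosure I ≤ vClosure I := by
  rintro x ⟨J, _, hJI, hx⟩
  exact vClosure_mono hJI hx

theorem tClosure_mono {I J : FractionalIdeal D⁰ K} (h : I ≤ J) : tClosure I ≤ tClosure J := by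
  rintro x ⟨L, hL, hLI, hx⟩
  exact ⟨L, hL, hLI.trans h, hx⟩

theorem le_tClosure (I : FractionalIdeal D⁰ K) : I ≤ tClosure I := by
  intro x hx
  refine ⟨FractionalIdeal.spanSingleton D⁰ x, ?_, ?_, ?_⟩
  · rw [FractionalIdeal.coe_spanSingleton]; exact Submodule.fg_span_singleton x
  · exact FractionalIdeal.spanSingleton_le_iff_mem.2 hx
  · exact le_vClosure _ (FractionalIdeal.mem_spanSingleton_self _ x)

theorem tClosure_inv (I : FractionalIdeal D⁰ K) : tClosure I⁻¹ = I⁻¹ :=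
  le_antisymm ((tClosure_le_vClosure _).trans (vClosure_inv I).le) (le_tClosure _)

theorem tClosure_one : tClosure (1 : FractionalIdeal D⁰ K) = 1 := by
  have h : (1 : FractionalIdeal D⁰ K)⁻¹ = 1 := by
    rw [FractionalIdeal.inv_eq, FractionalIdeal.div_one]
  rw [← h, tClosure_inv]

theorem tClosure_zero : tClosure (0 : FractionalIdeal D⁰ K) = 0 := by
  rw [← FractionalIdeal.inv_zero' (K := K) (R₁ := D), tClosure_inv]

/-- A finitely generated fractional ideal inside `I_t` lies in `J_v` for a single
finitely generated `J ⊆ I`. -/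
theorem exists_le_vClosure_of_fg {I L : FractionalIdeal D⁰ K} (hL : (L : Submodule D K).FG)
    (h : L ≤ tClosure I) :
    ∃ J : FractionalIdeal D⁰ K, (J : Submodule D K).FG ∧ J ≤ I ∧ L ≤ vClosure J := by
  obtain ⟨s, hs⟩ := hL
  have key : ∀ s : Finset K, (∀ x ∈ s, x ∈ tClosure I) →
      ∃ J : FractionalIdeal D⁰ K, (J : Submodule D K).FG ∧ J ≤ I ∧ ∀ x ∈ s, x ∈ vClosure J := by
    classical
    intro s
    induction s using Finset.induction_on with
    | empty =>
      intro _
      exact ⟨0, by simpa using Submodule.fg_bot, bot_le, by simp⟩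
    | insert a s _ ih =>
      intro hs
      obtain ⟨J, hJ, hJI, hx⟩ := ih fun x hx => hs x (Finset.mem_insert_of_mem hx)
      obtain ⟨M, hM, hMI, ha⟩ := hs a (Finset.mem_insert_self a s)
      refine ⟨M ⊔ J, ?_, sup_le hMI hJI, fun x hxs => ?_⟩
      · rw [FractionalIdeal.coe_sup]; exact hM.sup hJ
      · rcases Finset.mem_insert.1 hxs with rfl | hxs
        · exact vClosure_mono le_sup_left ha
        · exact vClosure_mono le_sup_right (hx x hxs)
  obtain ⟨J, hJ, hJI, hx⟩ := key s fun x hx => h (show x ∈ (L : Submodule D K) from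
    hs ▸ Submodule.subset_span hx)
  refine ⟨J, hJ, hJI, ?_⟩
  rw [← FractionalIdeal.coe_le_coe, ← hs]
  exact Submodule.span_le.2 hx

theorem tClosure_tClosure (I : FractionalIdeal D⁰ K) : tClosure (tClosure I) = tClosure I := by
  refine le_antisymm ?_ (le_tClosure _)
  rintro x ⟨L, hL, hLI, hx⟩
  obtain ⟨J, hJ, hJI, hLJ⟩ := exists_le_vClosure_of_fg hL hLI
  exact ⟨J, hJ, hJI, (vClosure_vClosure J).le (vClosure_mono hLJ hx)⟩

theorem spanSingleton_mul_vClosure_le (c : K) (J : FractionalIdeal D⁰ K) :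
    FractionalIdeal.spanSingleton D⁰ c * vClosure J ≤
      vClosure (FractionalIdeal.spanSingleton D⁰ c * J) := by
  by_cases hc : c = 0
  · rw [hc, FractionalIdeal.spanSingleton_zero, zero_mul]; exact bot_le
  by_cases hJ : J = 0
  · rw [hJ, vClosure, FractionalIdeal.inv_zero', FractionalIdeal.inv_zero', mul_zero]; exact bot_le
  have hcJ : FractionalIdeal.spanSingleton D⁰ c * J ≠ 0 := by
    intro h
    refine hJ ?_
    rw [← one_mul J, ← FractionalIdeal.spanSingleton_one, ← inv_mul_cancel₀ hc,
      ← FractionalIdeal.spanSingleton_mul_spanSingleton, mul_assoc, h, mul_zero]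
  rw [vClosure, vClosure, FractionalIdeal.inv_eq (I := (FractionalIdeal.spanSingleton D⁰ c * J)⁻¹),
    FractionalIdeal.le_div_iff_mul_le (inv_ne_zero_of_ne_zero hcJ)]
  have h : FractionalIdeal.spanSingleton D⁰ c * (FractionalIdeal.spanSingleton D⁰ c * J)⁻¹ ≤ J⁻¹ := by
    rw [FractionalIdeal.inv_eq (I := J), FractionalIdeal.le_div_iff_mul_le hJ]
    calc FractionalIdeal.spanSingleton D⁰ c * (FractionalIdeal.spanSingleton D⁰ c * J)⁻¹ * J
        = (FractionalIdeal.spanSingleton D⁰ c * J) *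
            (FractionalIdeal.spanSingleton D⁰ c * J)⁻¹ := by ring
      _ ≤ 1 := FractionalIdeal.mul_one_div_le_one
  calc FractionalIdeal.spanSingleton D⁰ c * (J⁻¹)⁻¹ * (FractionalIdeal.spanSingleton D⁰ c * J)⁻¹
      = (J⁻¹)⁻¹ * (FractionalIdeal.spanSingleton D⁰ c *
          (FractionalIdeal.spanSingleton D⁰ c * J)⁻¹) := by ring
    _ ≤ (J⁻¹)⁻¹ * J⁻¹ := mul_le_mul_right h _
    _ = J⁻¹ * (J⁻¹)⁻¹ := mul_comm _ _
    _ ≤ 1 := FractionalIdeal.mul_one_div_le_one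

theorem mul_tClosure_le (I J : FractionalIdeal D⁰ K) : I * tClosure J ≤ tClosure (I * J) := by
  rw [FractionalIdeal.mul_le]
  rintro x hx y ⟨L, hL, hLJ, hy⟩
  refine ⟨FractionalIdeal.spanSingleton D⁰ x * L, ?_, ?_, ?_⟩
  · rw [FractionalIdeal.coe_mul, FractionalIdeal.coe_spanSingleton]
    exact (Submodule.fg_span_singleton x).mul hL
  · exact mul_le_mul' (FractionalIdeal.spanSingleton_le_iff_mem.2 hx) hLJ
  · exact spanSingleton_mul_vClosure_le x L
      (FractionalIdeal.mul_mem_mul (FractionalIdeal.mem_spanSingleton_self _ x) hy)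

theorem tClosure_mul_tClosure (I J : FractionalIdeal D⁰ K) :
    tClosure (I * tClosure J) = tClosure (I * J) :=
  le_antisymm ((tClosure_mono (mul_tClosure_le I J)).trans (tClosure_tClosure _).le)
    (tClosure_mono (mul_le_mul_right (le_tClosure J) I))

theorem tClosure_tClosure_mul (I J : FractionalIdeal D⁰ K) :
    tClosure (tClosure I * J) = tClosure (I * J) := by
  rw [mul_comm, tClosure_mul_tClosure, mul_comm]

/-- A fractional ideal `I` is `t`-invertible if `(I I⁻¹)_t = D`. (The zero ideal is not.) -/
def IsTInvertible (I : FractionalIdeal D⁰ K) : Prop := tClosure (I * I⁻¹) = 1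

theorem tClosure_eq_one_of_le {I J : FractionalIdeal D⁰ K} (hI : tClosure I = 1) (hIJ : I ≤ J)
    (hJ : J ≤ 1) : tClosure J = 1 :=
  le_antisymm ((tClosure_mono hJ).trans tClosure_one.le) (hI ▸ tClosure_mono hIJ)

/-- If `(I J)_t = D`, then `I` is `t`-invertible. -/
theorem isTInvertible_of_mul {I J : FractionalIdeal D⁰ K} (h : tClosure (I * J) = 1) :
    IsTInvertible I := by
  have hI : I ≠ 0 := by
    rintro rfl
    rw [zero_mul, tClosure_zero] at h
    exact zero_ne_one h
  refine tClosure_eq_one_of_le h (mul_le_mul_right ?_ I) FractionalIdeal.mul_one_div_le_one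
  rw [FractionalIdeal.inv_eq, FractionalIdeal.le_div_iff_mul_le hI, mul_comm]
  exact (le_tClosure _).trans h.le

end

section

variable (D : Type*) [CommRing D] [IsDomain D] (K : Type*) [Field K] [Algebra D K]
  [IsFractionRing D K]

/-- The set `T_t(D)` of `t`-invertible fractional `t`-ideals of `D`. -/
def TInvertibleIdeals : Type _ :=
  {I : FractionalIdeal D⁰ K // tClosure I = I ∧ IsTInvertible I}

/-- `T_t(D)` is an abelian group under the `t`-product `(I, J) ↦ (I J)_t`. -/
instance instCommGroupTInvertibleIdeals : CommGroup (TInvertibleIdeals D K) where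
  mul I J := ⟨tClosure (I.1 * J.1), tClosure_tClosure _, by
    refine isTInvertible_of_mul (J := I.1⁻¹ * J.1⁻¹) ?_
    rw [tClosure_tClosure_mul, mul_mul_mul_comm, ← tClosure_tClosure_mul, show
      tClosure (I.1 * I.1⁻¹) = 1 from I.2.2, one_mul]
    exact J.2.2⟩
  one := ⟨1, tClosure_one, by
    refine isTInvertible_of_mul (J := 1) ?_
    rw [one_mul, tClosure_one]⟩
  inv I := ⟨I.1⁻¹, tClosure_inv _, by
    refine isTInvertible_of_mul (J := I.1) ?_
    rw [mul_comm]
    exact I.2.2⟩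
  mul_assoc I J L := Subtype.ext (by
    change tClosure (tClosure (I.1 * J.1) * L.1) = tClosure (I.1 * tClosure (J.1 * L.1))
    rw [tClosure_tClosure_mul, tClosure_mul_tClosure, mul_assoc])
  one_mul I := Subtype.ext (by
    change tClosure (1 * I.1) = I.1
    rw [one_mul]; exact I.2.1)
  mul_one I := Subtype.ext (by
    change tClosure (I.1 * 1) = I.1
    rw [mul_one]; exact I.2.1)
  inv_mul_cancel I := Subtype.ext (by
    change tClosure (I.1⁻¹ * I.1) = 1
    rw [mul_comm]; exact I.2.2)
  mul_comm I J := Subtype.ext (by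
    change tClosure (I.1 * J.1) = tClosure (J.1 * I.1)
    rw [mul_comm])

theorem TInvertibleIdeals.coe_mul (I J : TInvertibleIdeals D K) :
    (I * J).1 = tClosure (I.1 * J.1) := rfl

theorem TInvertibleIdeals.coe_one : (1 : TInvertibleIdeals D K).1 = 1 := rfl

theorem TInvertibleIdeals.coe_inv (I : TInvertibleIdeals D K) : (I⁻¹).1 = I.1⁻¹ := rfl

/-- The subgroup `Prin(D)` of nonzero principal fractional ideals. -/
def PrincipalTIdeals : Subgroup (TInvertibleIdeals D K) where
  carrier := {I | ∃ x : K, x ≠ 0 ∧ I.1 = FractionalIdeal.spanSingleton D⁰ x}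
  one_mem' := ⟨1, one_ne_zero, by
    rw [TInvertibleIdeals.coe_one, FractionalIdeal.spanSingleton_one]⟩
  inv_mem' := by
    rintro I ⟨x, hx, h⟩
    exact ⟨x⁻¹, inv_ne_zero hx, by
      rw [TInvertibleIdeals.coe_inv, h, FractionalIdeal.spanSingleton_inv]⟩
  mul_mem' := by
    rintro I J ⟨x, hx, hI⟩ ⟨y, hy, hJ⟩
    refine ⟨x * y, mul_ne_zero hx hy, ?_⟩
    rw [TInvertibleIdeals.coe_mul, hI, hJ, FractionalIdeal.spanSingleton_mul_spanSingleton,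
      ← inv_inv (x * y), ← FractionalIdeal.spanSingleton_inv, tClosure_inv]

/-- The `t`-class group `Cl_t(D) = T_t(D) / Prin(D)`. -/
abbrev TClassGroup : Type _ := TInvertibleIdeals D K ⧸ PrincipalTIdeals D K

variable {D}

/-- A `t`-ideal of `D`: a nonzero integral ideal `I` with `I_t = I`. -/
def IsTIdeal (I : Ideal D) : Prop :=
  I ≠ ⊥ ∧ tClosure (I : FractionalIdeal D⁰ K) = (I : FractionalIdeal D⁰ K)

/-- A maximal `t`-ideal: maximal among the proper `t`-ideals. -/
def IsMaximalTIdeal (M : Ideal D) : Prop :=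
  Maximal (fun I : Ideal D => IsTIdeal K I ∧ I ≠ ⊤) M

/-- A valuation ideal: `I V ∩ D = I` for some valuation overring `V` of `D` (the span is the
ideal `I V` of `V` generated by `I`, inside `K`). -/
def IsValuationIdeal (I : Ideal D) : Prop :=
  ∃ V : ValuationSubring K, (∀ d : D, algebraMap D K d ∈ V) ∧
    ∀ d : D, algebraMap D K d ∈ Submodule.span V (algebraMap D K '' (I : Set D)) ↔ d ∈ I

/-- A valuation element: a nonzero nonunit `a` such that `a D` is a valuation ideal. -/
def IsValuationElement (a : D) : Prop :=
  a ≠ 0 ∧ ¬ IsUnit a ∧ IsValuationIdeal K (Ideal.span {a})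

variable (D)

/-- An almost valuation factorization domain: every nonzero nonunit has a power which is a finite
product of valuation elements. -/
def IsAVFD : Prop :=
  ∀ a : D, a ≠ 0 → ¬ IsUnit a → ∃ n : ℕ, 0 < n ∧
    ∃ s : Multiset D, (∀ v ∈ s, IsValuationElement K v) ∧ a ^ n = s.prod

/-- A `t`-valuation ideal factorization domain: every nonzero principal ideal has the form
`(I₁ ⋯ Iₙ)_t` with `n ≥ 1` and valuation ideals `Iᵢ`. -/
def IsTVIFD : Prop :=
  ∀ a : D, a ≠ 0 → ∃ s : Multiset (Ideal D), s ≠ 0 ∧ (∀ I ∈ s, IsValuationIdeal K I) ∧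
    ((Ideal.span {a} : Ideal D) : FractionalIdeal D⁰ K) =
      tClosure ((s.prod : Ideal D) : FractionalIdeal D⁰ K)

/-- `D` is `t`-treed: the poset of prime `t`-ideals is treed, i.e. the prime `t`-ideals contained
in a given prime `t`-ideal form a chain. -/
def IsTTreed : Prop :=
  ∀ P Q M : Ideal D, P.IsPrime → IsTIdeal K P → Q.IsPrime → IsTIdeal K Q →
    M.IsPrime → IsTIdeal K M → P ≤ M → Q ≤ M → P ≤ Q ∨ Q ≤ P

/-- Weakly Matlis domain (`t`-h-local): every nonzero nonunit lies in only finitely many maximal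
`t`-ideals, and every prime `t`-ideal is contained in a unique maximal `t`-ideal. -/
def IsWeaklyMatlis : Prop :=
  (∀ a : D, a ≠ 0 → ¬ IsUnit a → {M : Ideal D | IsMaximalTIdeal K M ∧ a ∈ M}.Finite) ∧
    ∀ P : Ideal D, P.IsPrime → IsTIdeal K P → ∃! M : Ideal D, IsMaximalTIdeal K M ∧ P ≤ M

/-- Prüfer `v`-multiplication domain: every nonzero finitely generated ideal is `t`-invertible. -/
def IsPvMD : Prop :=
  ∀ I : Ideal D, I ≠ ⊥ → I.FG → IsTInvertible (I : FractionalIdeal D⁰ K)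

/-- Independent ring of Krull type: a weakly Matlis Prüfer `v`-multiplication domain. -/
def IsIndependentKrullType : Prop := IsWeaklyMatlis D K ∧ IsPvMD D K

end

/-- Almost GCD domain: for all `a, b` there is `n ≥ 1` such that `aⁿ D ∩ bⁿ D` is principal. -/
def IsAGCD (D : Type*) [CommRing D] : Prop :=
  ∀ a b : D, ∃ n : ℕ, 0 < n ∧
    Submodule.IsPrincipal ((Ideal.span {a ^ n} : Ideal D) ⊓ Ideal.span {b ^ n})

end

/-! The guiding principle is that `t`-closure, divisibility and `t`-invertibility can all be tested
at the maximal `t`-ideals (`dvd_of_forall_isMaximalTIdeal`, `isTInvertible_coeIdeal_iff`: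
`t`-invertible means `t`-locally principal). A PvMD is then a domain whose localizations at the
maximal `t`-ideals are valuation rings.

Two facts about valuation elements drive everything. A valuation element `a` lies in exactly one
maximal `t`-ideal, because the annihilators modulo `a` are totally ordered
(`IsValuationElement.eq_of_mem`). Moreover the radical of `aD` is a prime `t`-ideal, so in a
`t`-treed domain two valuation elements in the same maximal `t`-ideal divide one another in some
order (`IsValuationElement.dvd_or_dvd_of_mem`); `t`-treedness enters only here. If every nonzero
prime contains a valuation element, every nonzero element divides a product of such elements. The
first fact then makes `D` weakly Matlis, and the second makes its localizations at maximal
`t`-ideals valuation rings.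

Conversely, in a weakly Matlis domain with valuation localizations, distinct localizations are
independent, so an element can be split into parts, each supported at a single maximal `t`-ideal.
The parts are in general only ideals, which gives `IsWeaklyMatlis.isTVIFD`; almost gcds make them
principal after passing to a power (`IsWeaklyMatlis.isAlmostVF`). Torsion of the `t`-class group
corresponds to the same passage to powers: it turns a `t`-invertible valuation ideal into a
valuation element (`isValuationAt_of_tcl_pow_eq_span`).

For `D[X]`, a constant is a valuation element over `D[X]` exactly when it is one over `D`, by Gauss
extension and restriction of valuations. A nonconstant polynomial is factored in `K[X]`; torsion
makes a power of each irreducible factor, up to a constant, a polynomial of content one, and the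
Gauss lemma shows that this is a valuation element for the `p`-adic valuation of `K[X]`. -/

open scoped nonZeroDivisors Polynomial

noncomputable section

/-! ### The `t`-operation on integral ideals and maximal `t`-ideals -/

section TIdealClosure

variable {D : Type*} [CommRing D]

/-- The `t`-closure of an integral ideal, expressed by divisibility. -/
def Ideal.tcl (I : Ideal D) : Ideal D where
  carrier := {x | ∃ F : Finset D, (∀ f ∈ F, f ∈ I) ∧ ∀ e s, (∀ f ∈ F, e ∣ s * f) → e ∣ s * x}
  zero_mem' := ⟨∅, by simp, by simp⟩
  add_mem' := by
    classical
    rintro x y ⟨F, hF, hx⟩ ⟨G, hG, hy⟩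
    refine ⟨F ∪ G, fun f hf => (Finset.mem_union.1 hf).elim (hF f) (hG f), fun e s h => ?_⟩
    rw [mul_add]
    exact dvd_add (hx e s fun f hf => h f (Finset.mem_union_left _ hf))
      (hy e s fun f hf => h f (Finset.mem_union_right _ hf))
  smul_mem' := by
    rintro c x ⟨F, hF, hx⟩
    refine ⟨F, hF, fun e s h => ?_⟩
    rw [smul_eq_mul, mul_left_comm]
    exact (hx e s h).mul_left c

theorem Ideal.le_tcl (I : Ideal D) : I ≤ I.tcl := fun x hx =>
  ⟨{x}, by simpa using hx, fun e s h => h x (by simp)⟩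

theorem Ideal.tcl_mono {I J : Ideal D} (h : I ≤ J) : I.tcl ≤ J.tcl := by
  rintro x ⟨F, hF, hx⟩
  exact ⟨F, fun f hf => h (hF f hf), hx⟩

theorem Ideal.dvd_mul_of_mem_tcl {I : Ideal D} {e s x : D} (h : ∀ y ∈ I, e ∣ s * y)
    (hx : x ∈ I.tcl) : e ∣ s * x := by
  obtain ⟨F, hF, hx⟩ := hx
  exact hx e s fun f hf => h f (hF f hf)

/-- Used with `i ∈ I` and `s` outside a maximal `t`-ideal: a local generator `i` of `I` yields the
local generator `i ^ n` of `I ^ n`. -/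
theorem Ideal.pow_dvd_pow_mul_of_mem_pow {I : Ideal D} {i s y : D} (h : ∀ z ∈ I, i ∣ s * z) {n : ℕ}
    (hy : y ∈ I ^ n) : i ^ n ∣ s ^ n * y := by
  have h1 : Ideal.span {s} * I ≤ Ideal.span {i} := by
    rw [Ideal.span_singleton_mul_le_iff]
    exact fun z hz => Ideal.mem_span_singleton.2 (h z hz)
  have h2 := Ideal.pow_right_mono h1 n
  rw [mul_pow, Ideal.span_singleton_pow, Ideal.span_singleton_pow,
    Ideal.span_singleton_mul_le_iff] at h2
  exact Ideal.mem_span_singleton.1 (h2 y hy)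

theorem Ideal.tcl_span_singleton (b : D) : (Ideal.span {b}).tcl = Ideal.span {b} := by
  refine le_antisymm (fun x hx => ?_) (Ideal.le_tcl _)
  rw [Ideal.mem_span_singleton]
  have := Ideal.dvd_mul_of_mem_tcl (e := b) (s := 1)
    (fun y hy => by rw [one_mul]; exact Ideal.mem_span_singleton.1 hy) hx
  rwa [one_mul] at this

theorem Ideal.tcl_ne_bot {I : Ideal D} (h : I ≠ ⊥) : I.tcl ≠ ⊥ := fun h' =>
  h (le_bot_iff.1 (I.le_tcl.trans h'.le))

/-- The `t`-operation has finite character: the finitely many witnesses for one element already lie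
in one member of the chain. This is what makes Zorn's lemma applicable to `t`-ideals. -/
theorem Ideal.tcl_sSup_of_isChain {c : Set (Ideal D)} (hc : IsChain (· ≤ ·) c) (hne : c.Nonempty)
    (h : ∀ I ∈ c, I.tcl ≤ I) : (sSup c).tcl ≤ sSup c := by
  classical
  rintro x ⟨F, hF, hx⟩
  have key : ∀ G : Finset D, (∀ f ∈ G, f ∈ sSup c) → ∃ I ∈ c, ∀ f ∈ G, f ∈ I := by
    intro G
    induction G using Finset.induction_on with
    | empty => intro _; obtain ⟨I, hI⟩ := hne; exact ⟨I, hI, by simp⟩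
    | insert a s _ ih =>
      intro hG
      obtain ⟨I, hI, h1⟩ := ih fun f hf => hG f (Finset.mem_insert_of_mem hf)
      obtain ⟨J, hJ, h2⟩ := (Submodule.mem_sSup_of_directed hne hc.directedOn).1
        (hG a (Finset.mem_insert_self a s))
      rcases hc.total hI hJ with h | h
      · refine ⟨J, hJ, fun f hf => ?_⟩
        rcases Finset.mem_insert.1 hf with rfl | hf
        exacts [h2, h (h1 f hf)]
      · refine ⟨I, hI, fun f hf => ?_⟩
        rcases Finset.mem_insert.1 hf with rfl | hf
        exacts [h h2, h1 f hf]
  obtain ⟨I, hI, hFI⟩ := key F hF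
  exact le_sSup hI (h I hI ⟨F, hFI, hx⟩)

variable {K : Type*} [Field K] [Algebra D K] [IsFractionRing D K]

theorem mem_one_div_iff {a b : D} (hb : b ≠ 0) :
    algebraMap D K a / algebraMap D K b ∈ (1 : FractionalIdeal D⁰ K) ↔ b ∣ a := by
  have hb' : algebraMap D K b ≠ 0 := by simpa using hb
  rw [FractionalIdeal.mem_one_iff]
  constructor
  · rintro ⟨c, hc⟩
    rw [eq_div_iff hb', ← map_mul] at hc
    exact ⟨c, by rw [mul_comm, IsFractionRing.injective D K hc]⟩
  · rintro ⟨c, rfl⟩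
    exact ⟨c, by rw [eq_div_iff hb', ← map_mul, mul_comm]⟩

variable [IsDomain D]

theorem mem_vClosure_iff {J : FractionalIdeal D⁰ K} (hJ : J ≠ 0) {x : K} :
    x ∈ vClosure J ↔ ∀ z, (∀ y ∈ J, z * y ∈ (1 : FractionalIdeal D⁰ K)) →
      x * z ∈ (1 : FractionalIdeal D⁰ K) := by
  rw [vClosure, FractionalIdeal.mem_inv_iff (inv_ne_zero_of_ne_zero hJ)]
  simp only [FractionalIdeal.mem_inv_iff hJ]

theorem vClosure_zero : vClosure (0 : FractionalIdeal D⁰ K) = 0 := by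
  rw [vClosure, FractionalIdeal.inv_zero', FractionalIdeal.inv_zero']

/-- Write the elements of `J⁻¹` as fractions `s / e`; that `s / e` carries the generators into `D`
means `e ∣ s * f`. -/
theorem mem_vClosure_span_iff (F : Finset D) (x : D) :
    algebraMap D K x ∈ vClosure ((Ideal.span (F : Set D) : Ideal D) : FractionalIdeal D⁰ K) ↔
      ∀ e s, (∀ f ∈ F, e ∣ s * f) → e ∣ s * x := by
  by_cases h0 : Ideal.span (F : Set D) = ⊥
  · rw [h0, FractionalIdeal.coeIdeal_bot, vClosure_zero, FractionalIdeal.mem_zero_iff]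
    have hF : ∀ f ∈ F, f = 0 := fun f hf => by
      have : f ∈ Ideal.span (F : Set D) := Ideal.subset_span hf
      simpa [h0] using this
    constructor
    · intro h e s _
      have : x = 0 := by simpa using h
      simp [this]
    · intro h
      have := h 0 1 fun f hf => by simp [hF f hf]
      simpa using this
  · have h0' : ((Ideal.span (F : Set D) : Ideal D) : FractionalIdeal D⁰ K) ≠ 0 := by
      simpa using h0
    rw [mem_vClosure_iff h0']
    constructor
    · intro h e s hF
      -- The value `e = 0` gives no fraction, but then divisibility forces `s = 0`, since some
      -- generator is nonzero.
      by_cases he : e = 0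
      · subst he
        have hs : s = 0 := by
          by_contra hs
          refine h0 (Ideal.span_eq_bot.2 fun f hf => ?_)
          have := hF f hf
          rw [zero_dvd_iff] at this
          exact (mul_eq_zero.1 this).resolve_left hs
        simp [hs]
      · rw [← mem_one_div_iff (K := K) he, map_mul, mul_comm, mul_div_assoc]
        refine h _ fun y hy => ?_
        obtain ⟨y, hy', rfl⟩ := (FractionalIdeal.mem_coeIdeal _).1 hy
        rw [div_mul_eq_mul_div, ← map_mul, mem_one_div_iff he]
        have : Ideal.span (F : Set D) ≤ Submodule.comap (LinearMap.mulLeft D s) (Ideal.span {e}) :=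
          Ideal.span_le.2 fun f hf => Ideal.mem_span_singleton.2 (hF f hf)
        exact Ideal.mem_span_singleton.1 (this hy')
    · intro h z hz
      obtain ⟨s, e, he, rfl⟩ := IsFractionRing.div_surjective (A := D) z
      have he0 := nonZeroDivisors.ne_zero he
      rw [mul_comm, div_mul_eq_mul_div, ← map_mul, mem_one_div_iff he0]
      refine h e s fun f hf => ?_
      rw [← mem_one_div_iff (K := K) he0, map_mul, mul_div_right_comm]
      exact hz _ (FractionalIdeal.mem_coeIdeal_of_mem _ (Ideal.subset_span hf))

theorem tClosure_coeIdeal (I : Ideal D) :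
    tClosure (I : FractionalIdeal D⁰ K) = (I.tcl : FractionalIdeal D⁰ K) := by
  classical
  refine le_antisymm (fun x hx => ?_) (fun x hx => ?_)
  · have hx1 : x ∈ (1 : FractionalIdeal D⁰ K) := by
      rw [← tClosure_one]; exact tClosure_mono FractionalIdeal.coeIdeal_le_one hx
    obtain ⟨d, rfl⟩ := (FractionalIdeal.mem_one_iff _).1 hx1
    obtain ⟨J, ⟨S, hS⟩, hJI, hx⟩ := hx
    have : ∀ y ∈ S, ∃ f ∈ I, algebraMap D K f = y := fun y hy =>
      (FractionalIdeal.mem_coeIdeal _).1 (hJI (show y ∈ (J : Submodule D K) from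
        hS ▸ Submodule.subset_span hy))
    choose! g hg hg' using this
    refine FractionalIdeal.mem_coeIdeal_of_mem _ ⟨S.image g, ?_, ?_⟩
    · intro f hf
      obtain ⟨y, hy, rfl⟩ := Finset.mem_image.1 hf
      exact hg y hy
    · rw [← mem_vClosure_span_iff (K := K)]
      refine vClosure_mono ?_ hx
      rw [← FractionalIdeal.coe_le_coe, ← hS, Submodule.span_le]
      intro y hy
      rw [← hg' y hy]
      exact FractionalIdeal.mem_coeIdeal_of_mem _
        (Ideal.subset_span (Finset.mem_coe.2 (Finset.mem_image_of_mem g hy)))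
  · obtain ⟨d, ⟨F, hF, hd⟩, rfl⟩ := (FractionalIdeal.mem_coeIdeal _).1 hx
    refine ⟨((Ideal.span (F : Set D) : Ideal D) : FractionalIdeal D⁰ K), ?_, ?_,
      (mem_vClosure_span_iff F d).2 hd⟩
    · rw [FractionalIdeal.coe_coeIdeal, IsLocalization.coeSubmodule_fg K
        (IsFractionRing.injective D K)]
      exact ⟨F, rfl⟩
    · rw [FractionalIdeal.coeIdeal_le_coeIdeal]
      exact Ideal.span_le.2 hF

theorem Ideal.tcl_tcl (I : Ideal D) : I.tcl.tcl = I.tcl := by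
  have := tClosure_tClosure (I : FractionalIdeal D⁰ (FractionRing D))
  simpa only [tClosure_coeIdeal, FractionalIdeal.coeIdeal_inj] using this

theorem Ideal.tcl_tcl_mul (I J : Ideal D) : (I.tcl * J).tcl = (I * J).tcl := by
  have := tClosure_tClosure_mul (I : FractionalIdeal D⁰ (FractionRing D)) J
  simpa only [tClosure_coeIdeal, ← FractionalIdeal.coeIdeal_mul,
    FractionalIdeal.coeIdeal_inj] using this

theorem Ideal.tcl_mul_tcl (I J : Ideal D) : (I * J.tcl).tcl = (I * J).tcl := by
  rw [mul_comm, Ideal.tcl_tcl_mul, mul_comm]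

theorem isTIdeal_iff (I : Ideal D) : IsTIdeal K I ↔ I ≠ ⊥ ∧ I.tcl = I := by
  rw [IsTIdeal, tClosure_coeIdeal, FractionalIdeal.coeIdeal_inj]

theorem isTIdeal_of_tcl_le {I : Ideal D} (h : I ≠ ⊥) (hI : I.tcl ≤ I) : IsTIdeal K I :=
  (isTIdeal_iff I).2 ⟨h, le_antisymm hI I.le_tcl⟩

theorem IsTIdeal.tcl_le {I J : Ideal D} (hI : IsTIdeal K I) (h : J ≤ I) : J.tcl ≤ I :=
  (Ideal.tcl_mono h).trans ((isTIdeal_iff I).1 hI).2.le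

variable (K) in
theorem exists_isMaximalTIdeal_ge {I : Ideal D} (h0 : I ≠ ⊥) (h1 : I.tcl ≠ ⊤) :
    ∃ M, IsMaximalTIdeal K M ∧ I ≤ M := by
  obtain ⟨M, hIM, hM⟩ := zorn_le_nonempty₀ {J : Ideal D | IsTIdeal K J ∧ J ≠ ⊤} (by
    intro c hc hch y hy
    refine ⟨sSup c, ⟨isTIdeal_of_tcl_le ?_ ?_, ?_⟩, fun z hz => le_sSup hz⟩
    · intro h
      exact (hc hy).1.1 (le_bot_iff.1 ((le_sSup hy).trans h.le))
    · exact Ideal.tcl_sSup_of_isChain hch ⟨y, hy⟩ fun J hJ => (hc hJ).1.tcl_le le_rfl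
    · intro h
      have : (1 : D) ∈ sSup c := h ▸ Submodule.mem_top
      obtain ⟨J, hJ, h2⟩ := (Submodule.mem_sSup_of_directed ⟨y, hy⟩ hch.directedOn).1 this
      exact (hc hJ).2 ((Ideal.eq_top_iff_one _).2 h2)) I.tcl
    ⟨isTIdeal_of_tcl_le (Ideal.tcl_ne_bot h0) I.tcl_tcl.le, h1⟩
  exact ⟨M, hM, I.le_tcl.trans hIM⟩

theorem IsMaximalTIdeal.isTIdeal {M : Ideal D} (hM : IsMaximalTIdeal K M) : IsTIdeal K M :=
  hM.prop.1

theorem IsMaximalTIdeal.ne_top {M : Ideal D} (hM : IsMaximalTIdeal K M) : M ≠ ⊤ := hM.prop.2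

theorem IsMaximalTIdeal.tcl_eq_top {M I : Ideal D} (hM : IsMaximalTIdeal K M) (h : M < I) :
    I.tcl = ⊤ := by
  by_contra h'
  have hI : I ≠ ⊥ := ((bot_lt_iff_ne_bot.2 hM.isTIdeal.1).trans h).ne'
  exact (h.trans_le I.le_tcl).not_ge
    (hM.le_of_ge ⟨isTIdeal_of_tcl_le (Ideal.tcl_ne_bot hI) I.tcl_tcl.le, h'⟩
      (h.le.trans I.le_tcl))

/-- If `x, y ∉ M`, then `(M, x)` and `(M, y)` both have `t`-closure `D`, hence so does their
product; for `x * y ∈ M` that product lies in the `t`-ideal `M`. -/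
theorem IsMaximalTIdeal.isPrime {M : Ideal D} (hM : IsMaximalTIdeal K M) : M.IsPrime := by
  refine ⟨hM.ne_top, fun {x y} hxy => ?_⟩
  by_contra! h
  have key : ∀ z ∉ M, (M ⊔ Ideal.span {z}).tcl = ⊤ := fun z hz =>
    hM.tcl_eq_top (lt_of_le_of_ne le_sup_left fun h => hz (h ▸
      Ideal.mem_sup_right (Ideal.mem_span_singleton_self z)))
  have h2 : ((M ⊔ Ideal.span {x}) * (M ⊔ Ideal.span {y})).tcl = ⊤ := by
    rw [← Ideal.tcl_tcl_mul, key x h.1, Ideal.top_mul, key y h.2]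
  refine hM.ne_top (top_le_iff.1 (h2 ▸ hM.isTIdeal.tcl_le ?_))
  rw [Ideal.sup_mul]
  refine sup_le Ideal.mul_le_left ?_
  rw [Ideal.mul_sup]
  refine sup_le Ideal.mul_le_right ?_
  rw [Ideal.span_singleton_mul_span_singleton, Ideal.span_singleton_le_iff_mem]
  exact hxy

theorem IsMaximalTIdeal.exists_notMem {M N : Ideal D} (hM : IsMaximalTIdeal K M)
    (hN : IsMaximalTIdeal K N) (h : M ≠ N) : ∃ x ∈ M, x ∉ N := by
  by_contra! h'
  exact h (le_antisymm h' (hM.le_of_ge hN.prop h'))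

variable (K) in
/-- Membership in the `t`-closure can be checked locally at the maximal `t`-ideals. -/
theorem mem_tcl_of_forall_isMaximalTIdeal {I : Ideal D} (hI : I ≠ ⊥) {x : D}
    (h : ∀ M, IsMaximalTIdeal K M → ∃ s ∉ M, s * x ∈ I) : x ∈ I.tcl := by
  -- The conductor `(I : x)` contains `I`, so it is nonzero. By hypothesis it lies in no maximal
  -- `t`-ideal, so its `t`-closure is `D`, and `x ∈ (xC)_t ⊆ I_t`.
  set C : Ideal D := Submodule.comap (LinearMap.mulRight D x) I
  have hIC : I ≤ C := fun y hy => Ideal.mul_mem_right x I hy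
  have hC1 : C.tcl = ⊤ := by
    by_contra hne
    obtain ⟨M, hM, hCM⟩ := exists_isMaximalTIdeal_ge K (fun h => hI (le_bot_iff.1 (h ▸ hIC))) hne
    obtain ⟨s, hs, hsx⟩ := h M hM
    exact hs (hCM hsx)
  have h1 : (Ideal.span {x} * C).tcl ≤ I.tcl := by
    refine Ideal.tcl_mono ?_
    rw [Ideal.span_singleton_mul_le_iff]
    intro z hz
    rw [mul_comm]
    exact hz
  refine h1 ?_
  rw [← Ideal.tcl_mul_tcl, hC1, Ideal.mul_top]
  exact Ideal.le_tcl _ (Ideal.mem_span_singleton_self x)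

variable (K) in
/-- Divisibility can be checked locally at the maximal `t`-ideals. -/
theorem dvd_of_forall_isMaximalTIdeal {b y : D} (hb : b ≠ 0)
    (h : ∀ M, IsMaximalTIdeal K M → ∃ s ∉ M, b ∣ s * y) : b ∣ y := by
  rw [← Ideal.mem_span_singleton, ← Ideal.tcl_span_singleton]
  refine mem_tcl_of_forall_isMaximalTIdeal K (by simpa using hb) fun M hM => ?_
  obtain ⟨s, hs, h⟩ := h M hM
  exact ⟨s, hs, Ideal.mem_span_singleton.2 h⟩

/-- The hypothesis says that `1` belongs to the `t`-closure of `(a, b)`. -/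
theorem IsMaximalTIdeal.notMem_of_coprime {M : Ideal D} (hM : IsMaximalTIdeal K M) {a b : D}
    (h : ∀ e s, e ∣ s * a → e ∣ s * b → e ∣ s) (ha : a ∈ M) : b ∉ M := by
  classical
  intro hb
  refine hM.ne_top ((Ideal.eq_top_iff_one _).2 ?_)
  refine hM.isTIdeal.tcl_le le_rfl ⟨{a, b}, by simp [ha, hb], fun e s hs => ?_⟩
  rw [mul_one]
  exact h e s (hs a (by simp)) (hs b (by simp))

variable (K) in
theorem exists_isMaximalTIdeal_mem {a : D} (ha : a ≠ 0) (hu : ¬ IsUnit a) :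
    ∃ M, IsMaximalTIdeal K M ∧ a ∈ M := by
  obtain ⟨M, hM, h⟩ := exists_isMaximalTIdeal_ge K (I := Ideal.span {a}) (by simpa using ha)
    (by rwa [Ideal.tcl_span_singleton, Ne, Ideal.span_singleton_eq_top])
  exact ⟨M, hM, h (Ideal.mem_span_singleton_self a)⟩

end TIdealClosure

/-! ### `t`-invertibility and torsion of the `t`-class group -/

section TClassGroup

variable {D : Type*} [CommRing D] [IsDomain D] {K : Type*} [Field K] [Algebra D K]
  [IsFractionRing D K]

/-- The integral ideal `J = I I⁻¹` has `t`-closure `D` exactly when it lies in no maximal `t`-ideal.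
An element `s = i z` of `J` with `i ∈ I`, `z ∈ I⁻¹` satisfies `s j = i (z j)` with `z j ∈ D`;
conversely, if `i` divides all `s j`, then `s / i ∈ I⁻¹` and `s ∈ J`. -/
theorem isTInvertible_coeIdeal_iff {I : Ideal D} (hI : I ≠ ⊥) :
    IsTInvertible (I : FractionalIdeal D⁰ K) ↔
      ∀ M, IsMaximalTIdeal K M → ∃ i ∈ I, ∃ s ∉ M, ∀ j ∈ I, i ∣ s * j := by
  have hI' : (I : FractionalIdeal D⁰ K) ≠ 0 := by simpa using hI
  obtain ⟨J, hJ⟩ := FractionalIdeal.le_one_iff_exists_coeIdeal.1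
    (FractionalIdeal.mul_one_div_le_one (I := (I : FractionalIdeal D⁰ K)))
  rw [← FractionalIdeal.inv_eq] at hJ
  have hIJ : I ≤ J := by
    rw [← FractionalIdeal.coeIdeal_le_coeIdeal K, hJ]
    refine le_mul_of_one_le_right' ?_
    rw [FractionalIdeal.one_le, FractionalIdeal.mem_inv_iff hI']
    intro y hy
    rw [one_mul]
    exact FractionalIdeal.coeIdeal_le_one hy
  have hmem : ∀ i ∈ I, ∀ s : D, (∀ j ∈ I, i ∣ s * j) → s ≠ 0 → s ∈ J := by
    intro i hi s h hs
    have hi0 : i ≠ 0 := by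
      rintro rfl
      refine hI ((Submodule.eq_bot_iff _).2 fun j hj => ?_)
      exact (mul_eq_zero.1 (zero_dvd_iff.1 (h j hj))).resolve_left hs
    have hi0' : algebraMap D K i ≠ 0 := by simpa using hi0
    have : algebraMap D K s / algebraMap D K i ∈ (I : FractionalIdeal D⁰ K)⁻¹ := by
      rw [FractionalIdeal.mem_inv_iff hI']
      intro y hy
      obtain ⟨j, hj, rfl⟩ := (FractionalIdeal.mem_coeIdeal _).1 hy
      rw [div_mul_eq_mul_div, ← map_mul, mem_one_div_iff hi0]
      exact h j hj
    have h2 := FractionalIdeal.mul_mem_mul (FractionalIdeal.mem_coeIdeal_of_mem D⁰ hi) this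
    rw [mul_div_cancel₀ _ hi0', ← hJ] at h2
    obtain ⟨s', hs', h3⟩ := (FractionalIdeal.mem_coeIdeal _).1 h2
    rwa [← IsFractionRing.injective D K h3]
  rw [IsTInvertible, ← hJ, tClosure_coeIdeal, ← FractionalIdeal.coeIdeal_top,
    FractionalIdeal.coeIdeal_inj]
  constructor
  · intro h M hM
    -- If no product `i z` avoids `M`, then `J ⊆ M`, because these products generate `J`.
    by_contra! hne
    refine hM.ne_top (top_le_iff.1 (h ▸ hM.isTIdeal.tcl_le ?_))
    rw [← FractionalIdeal.coeIdeal_le_coeIdeal K, hJ, FractionalIdeal.mul_le]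
    rintro _ hi z hz
    obtain ⟨i, hi', rfl⟩ := (FractionalIdeal.mem_coeIdeal _).1 hi
    rw [FractionalIdeal.mem_inv_iff hI'] at hz
    obtain ⟨s, hs⟩ := (FractionalIdeal.mem_one_iff _).1 (hz _ hi)
    rw [mul_comm, ← hs]
    refine FractionalIdeal.mem_coeIdeal_of_mem _ ?_
    by_contra hsM
    obtain ⟨j, hj, hij⟩ := hne i hi' s hsM
    obtain ⟨w, hw⟩ := (FractionalIdeal.mem_one_iff _).1
      (hz _ (FractionalIdeal.mem_coeIdeal_of_mem _ hj))
    refine hij ⟨w, IsFractionRing.injective D K ?_⟩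
    rw [map_mul, map_mul, hs, hw]
    ring
  · intro h
    by_contra hne
    obtain ⟨M, hM, hJM⟩ := exists_isMaximalTIdeal_ge K
      (fun h => hI (le_bot_iff.1 (h ▸ hIJ))) hne
    obtain ⟨i, hi, s, hs, hij⟩ := h M hM
    exact hs (hJM (hmem i hi s hij fun h0 => hs (h0 ▸ M.zero_mem)))

theorem TInvertibleIdeals.coe_pow (A : TInvertibleIdeals D K) (n : ℕ) :
    (A ^ n).1 = tClosure (A.1 ^ n) := by
  induction n with
  | zero => rw [pow_zero, pow_zero, TInvertibleIdeals.coe_one, tClosure_one]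
  | succ n ih => rw [pow_succ, TInvertibleIdeals.coe_mul, ih, tClosure_tClosure_mul, pow_succ]

theorem Ideal.tcl_tcl_pow (I : Ideal D) (n : ℕ) : (I.tcl ^ n).tcl = (I ^ n).tcl := by
  induction n with
  | zero => rw [pow_zero, pow_zero]
  | succ n ih =>
    rw [pow_succ, Ideal.tcl_mul_tcl, ← Ideal.tcl_tcl_mul, ih, Ideal.tcl_tcl_mul, pow_succ]

theorem tClosure_tClosure_pow (A : FractionalIdeal D⁰ K) (n : ℕ) :
    tClosure (tClosure A ^ n) = tClosure (A ^ n) := by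
  induction n with
  | zero => rw [pow_zero, pow_zero]
  | succ n ih =>
    rw [pow_succ, tClosure_mul_tClosure, ← tClosure_tClosure_mul, ih, tClosure_tClosure_mul,
      pow_succ]

theorem IsTInvertible.ne_zero {A : FractionalIdeal D⁰ K} (h : IsTInvertible A) : A ≠ 0 := by
  rintro rfl
  rw [IsTInvertible, zero_mul, tClosure_zero] at h
  exact zero_ne_one h

theorem isMulTorsion_tClassGroup_iff : IsMulTorsion (TClassGroup D K) ↔
    ∀ A : TInvertibleIdeals D K, ∃ n, 0 < n ∧
      ∃ x : K, x ≠ 0 ∧ tClosure (A.1 ^ n) = FractionalIdeal.spanSingleton D⁰ x := by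
  constructor
  · intro h A
    obtain ⟨n, hn, hA⟩ := (isOfFinOrder_iff_pow_eq_one.1 (h (QuotientGroup.mk A)))
    rw [← QuotientGroup.mk_pow, QuotientGroup.eq_one_iff] at hA
    obtain ⟨x, hx, h⟩ := hA
    exact ⟨n, hn, x, hx, by rw [← TInvertibleIdeals.coe_pow, h]⟩
  · intro h g
    obtain ⟨A, rfl⟩ := QuotientGroup.mk_surjective g
    obtain ⟨n, hn, x, hx, hA⟩ := h A
    refine isOfFinOrder_iff_pow_eq_one.2 ⟨n, hn, ?_⟩
    rw [← QuotientGroup.mk_pow, QuotientGroup.eq_one_iff]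
    exact ⟨x, hx, by rw [TInvertibleIdeals.coe_pow, hA]⟩

theorem isTInvertible_tClosure {A : FractionalIdeal D⁰ K} (h : IsTInvertible A) :
    IsTInvertible (tClosure A) := by
  refine isTInvertible_of_mul (J := A⁻¹) ?_
  rw [tClosure_tClosure_mul]
  exact h

theorem exists_tcl_pow_eq_span (h : IsMulTorsion (TClassGroup D K)) {I : Ideal D}
    (hI : IsTInvertible (I : FractionalIdeal D⁰ K)) :
    ∃ n, 0 < n ∧ ∃ d : D, d ≠ 0 ∧ (I ^ n).tcl = Ideal.span {d} := by
  obtain ⟨n, hn, x, hx, hA⟩ := isMulTorsion_tClassGroup_iff.1 h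
    ⟨tClosure I, tClosure_tClosure _, isTInvertible_tClosure hI⟩
  refine ⟨n, hn, ?_⟩
  change tClosure (tClosure _ ^ n) = _ at hA
  rw [tClosure_tClosure_pow, ← FractionalIdeal.coeIdeal_pow, tClosure_coeIdeal] at hA
  have h1 : x ∈ (1 : FractionalIdeal D⁰ K) := FractionalIdeal.coeIdeal_le_one
    (hA ▸ FractionalIdeal.mem_spanSingleton_self D⁰ x)
  obtain ⟨d, rfl⟩ := (FractionalIdeal.mem_one_iff _).1 h1
  refine ⟨d, by simpa using hx, ?_⟩
  rwa [← FractionalIdeal.coeIdeal_span_singleton, FractionalIdeal.coeIdeal_inj] at hA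

/-- Clearing denominators does not change the class, so integral ideals suffice. -/
theorem isMulTorsion_tClassGroup_of_forall_ideal
    (h : ∀ I : Ideal D, I ≠ ⊥ → IsTInvertible (I : FractionalIdeal D⁰ K) →
      ∃ n, 0 < n ∧ ∃ d : D, d ≠ 0 ∧ (I ^ n).tcl = Ideal.span {d}) :
    IsMulTorsion (TClassGroup D K) := by
  refine isMulTorsion_tClassGroup_iff.2 fun A => ?_
  obtain ⟨a, I, ha, hA⟩ := FractionalIdeal.exists_eq_spanSingleton_mul A.1
  have ha' : algebraMap D K a ≠ 0 := by simpa using ha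
  have hA0 : A.1 ≠ 0 := A.2.2.ne_zero
  have hI : I ≠ ⊥ := by
    rintro rfl
    rw [FractionalIdeal.coeIdeal_bot, mul_zero] at hA
    exact hA0 hA
  have hIA : (I : FractionalIdeal D⁰ K) =
      FractionalIdeal.spanSingleton D⁰ (algebraMap D K a) * A.1 := by
    rw [hA, ← mul_assoc, FractionalIdeal.spanSingleton_mul_spanSingleton, mul_inv_cancel₀ ha',
      FractionalIdeal.spanSingleton_one, one_mul]
  have hIinv : IsTInvertible (I : FractionalIdeal D⁰ K) := by
    refine isTInvertible_of_mul
      (J := FractionalIdeal.spanSingleton D⁰ (algebraMap D K a)⁻¹ * A.1⁻¹) ?_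
    rw [hIA, mul_mul_mul_comm, FractionalIdeal.spanSingleton_mul_spanSingleton,
      mul_inv_cancel₀ ha', FractionalIdeal.spanSingleton_one, one_mul]
    exact A.2.2
  obtain ⟨n, hn, d, hd, h⟩ := h I hI hIinv
  refine ⟨n, hn, (algebraMap D K a)⁻¹ ^ n * algebraMap D K d,
    mul_ne_zero (pow_ne_zero _ (inv_ne_zero ha')) (by simpa using hd), ?_⟩
  have h2 : tClosure ((I : FractionalIdeal D⁰ K) ^ n) =
      FractionalIdeal.spanSingleton D⁰ (algebraMap D K d) := by
    rw [← FractionalIdeal.coeIdeal_pow, tClosure_coeIdeal, h,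
      FractionalIdeal.coeIdeal_span_singleton]
  rw [hA, mul_pow, FractionalIdeal.spanSingleton_pow, ← tClosure_mul_tClosure, h2,
    FractionalIdeal.spanSingleton_mul_spanSingleton, ← inv_inv (_ * _ : K),
    ← FractionalIdeal.spanSingleton_inv, tClosure_inv]

end TClassGroup

/-! ### Valuation elements and maximal `t`-ideals -/

section ValuationElements

variable {D : Type*} [CommRing D] {K : Type*} [Field K] [Algebra D K]

/-- The principal ideal of the nonzero element `a` is a valuation ideal with respect to `V`. -/
def IsValuationAt (V : ValuationSubring K) (a : D) : Prop :=
  a ≠ 0 ∧ (∀ d : D, algebraMap D K d ∈ V) ∧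
    ∀ y : D, algebraMap D K y / algebraMap D K a ∈ V → a ∣ y

variable (K) in
/-- Some power of `x` is, up to a unit, a product of valuation elements. -/
def IsAlmostVF (x : D) : Prop :=
  ∃ n : ℕ, 0 < n ∧ ∃ u : D, IsUnit u ∧ ∃ s : Multiset D, (∀ v ∈ s, IsValuationElement K v) ∧
    x ^ n = u * s.prod

theorem IsAlmostVF.mul {x y : D} (hx : IsAlmostVF K x) (hy : IsAlmostVF K y) :
    IsAlmostVF K (x * y) := by
  obtain ⟨n, hn, u, hu, s, hs, h⟩ := hx
  obtain ⟨m, hm, v, hv, t, ht, h'⟩ := hy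
  refine ⟨n * m, Nat.mul_pos hn hm, u ^ m * v ^ n, (hu.pow m).mul (hv.pow n), m • s + n • t, ?_, ?_⟩
  · intro w hw
    rcases Multiset.mem_add.1 hw with hw | hw
    · exact hs w (Multiset.mem_of_mem_nsmul hw)
    · exact ht w (Multiset.mem_of_mem_nsmul hw)
  · rw [mul_pow, pow_mul, h, mul_comm n m, pow_mul, h', Multiset.prod_add, Multiset.prod_nsmul,
      Multiset.prod_nsmul]
    ring

theorem IsUnit.isAlmostVF {x : D} (hx : IsUnit x) : IsAlmostVF K x :=
  ⟨1, one_pos, x, hx, 0, by simp, by simp⟩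

theorem IsValuationElement.isAlmostVF {x : D} (hx : IsValuationElement K x) : IsAlmostVF K x :=
  ⟨1, one_pos, 1, isUnit_one, {x}, by simpa using hx, by simp⟩

theorem IsAlmostVF.pow {x : D} (hx : IsAlmostVF K x) (n : ℕ) : IsAlmostVF K (x ^ n) := by
  induction n with
  | zero => rw [pow_zero]; exact isUnit_one.isAlmostVF
  | succ n ih => rw [pow_succ]; exact ih.mul hx

theorem IsAlmostVF.of_pow {x : D} {n : ℕ} (hn : 0 < n) (h : IsAlmostVF K (x ^ n)) :
    IsAlmostVF K x := by
  obtain ⟨m, hm, h⟩ := h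
  exact ⟨n * m, Nat.mul_pos hn hm, by rwa [pow_mul]⟩

variable [IsFractionRing D K]

theorem isValuationElement_iff {a : D} :
    IsValuationElement K a ↔ ¬ IsUnit a ∧ ∃ V : ValuationSubring K, IsValuationAt V a := by
  have key : ∀ V : ValuationSubring K, (∀ d : D, algebraMap D K d ∈ V) → a ≠ 0 → ∀ d : D,
      algebraMap D K d ∈ Submodule.span V (algebraMap D K '' (Ideal.span {a} : Set D)) ↔
        algebraMap D K d / algebraMap D K a ∈ V := by
    intro V hV ha d
    have ha' : algebraMap D K a ≠ 0 := by simpa using ha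
    have : Submodule.span V (algebraMap D K '' (Ideal.span {a} : Set D)) =
        Submodule.span V {algebraMap D K a} := by
      refine le_antisymm (Submodule.span_le.2 ?_) (Submodule.span_mono ?_)
      · rintro _ ⟨y, hy, rfl⟩
        obtain ⟨z, rfl⟩ := Ideal.mem_span_singleton.1 hy
        refine Submodule.mem_span_singleton.2 ⟨⟨algebraMap D K z, hV z⟩, ?_⟩
        rw [map_mul, mul_comm]
        rfl
      · rintro _ rfl
        exact ⟨a, Ideal.mem_span_singleton_self a, rfl⟩
    rw [this, Submodule.mem_span_singleton]
    constructor
    · rintro ⟨v, hv⟩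
      rw [← hv]
      change (v : K) * algebraMap D K a / _ ∈ V
      rw [mul_div_cancel_right₀ _ ha']
      exact v.2
    · intro h
      exact ⟨⟨_, h⟩, div_mul_cancel₀ _ ha'⟩
  constructor
  · rintro ⟨ha, hu, V, hV, h⟩
    refine ⟨hu, V, ha, hV, fun y hy => ?_⟩
    rw [← Ideal.mem_span_singleton]
    exact (h y).1 ((key V hV ha y).2 hy)
  · rintro ⟨hu, V, ha, hV, h⟩
    refine ⟨ha, hu, V, hV, fun d => ?_⟩
    rw [key V hV ha, Ideal.mem_span_singleton]
    refine ⟨h d, ?_⟩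
    rintro ⟨z, rfl⟩
    rw [map_mul, mul_div_cancel_left₀ _ (by simpa using ha)]
    exact hV z

/-- Let `a` divide `(x y) ^ k` and let `x / y ∈ V`. Then `x ^ (2 k) = (x / y) ^ k (x y) ^ k` lies in
`aV ∩ D = aD`. Otherwise `y / x ∈ V`, and the roles are exchanged. -/
theorem IsValuationAt.isPrime_radical {V : ValuationSubring K} {a : D} (h : IsValuationAt V a)
    (hu : ¬ IsUnit a) : (Ideal.span {a}).radical.IsPrime := by
  refine ⟨?_, ?_⟩
  · rwa [Ne, Ideal.radical_eq_top, Ideal.span_singleton_eq_top]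
  · have ha' : algebraMap D K a ≠ 0 := by simpa using h.1
    have key : ∀ x y : D, x * y ∈ (Ideal.span {a}).radical → y ≠ 0 →
        algebraMap D K x / algebraMap D K y ∈ V → x ∈ (Ideal.span {a}).radical := by
      rintro x y ⟨k, hk⟩ hy hv
      obtain ⟨w, hw⟩ := Ideal.mem_span_singleton.1 hk
      refine ⟨2 * k, Ideal.mem_span_singleton.2 (h.2.2 _ ?_)⟩
      have hy' : algebraMap D K y ≠ 0 := by simpa using hy
      convert V.mul_mem _ _ (pow_mem hv k : (_ : K) ∈ V) (h.2.1 w) using 1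
      have hw' : (algebraMap D K x * algebraMap D K y) ^ k = algebraMap D K a * algebraMap D K w := by
        rw [← map_mul, ← map_mul, ← map_pow, hw]
      rw [map_pow, div_pow, div_eq_iff ha', mul_assoc, mul_comm (algebraMap D K w), ← hw',
        mul_pow, two_mul, pow_add]
      field_simp
    intro x y hxy
    by_cases hy : y = 0
    · right; rw [hy]; exact Ideal.zero_mem _
    by_cases hx : x = 0
    · left; rw [hx]; exact Ideal.zero_mem _
    rcases V.mem_or_inv_mem (algebraMap D K x / algebraMap D K y) with hv | hv
    · exact Or.inl (key x y hxy hy hv)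
    · rw [inv_div] at hv
      exact Or.inr (key y x (by rwa [mul_comm]) hx hv)

variable [IsDomain D]

/-- One factor `a` is split off at a time: `y / a ^ (n + 1) ∈ V` implies `y / a ∈ V`, hence `a ∣ y`.
-/
theorem IsValuationAt.pow {V : ValuationSubring K} {a : D} (h : IsValuationAt V a) (n : ℕ) :
    IsValuationAt V (a ^ n) := by
  obtain ⟨ha, hV, h⟩ := h
  have ha' : algebraMap D K a ≠ 0 := by simpa using ha
  refine ⟨pow_ne_zero n ha, hV, ?_⟩
  induction n with
  | zero => simp
  | succ n ih =>
    intro y hy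
    obtain ⟨z, rfl⟩ := h y (by
      convert V.mul_mem _ _ hy (hV (a ^ n)) using 1
      rw [map_pow, map_pow, pow_succ]
      field_simp)
    rw [pow_succ']
    refine mul_dvd_mul_left a (ih z ?_)
    convert hy using 1
    rw [map_mul, map_pow, map_pow, pow_succ]
    field_simp

theorem IsValuationAt.mul_unit {V : ValuationSubring K} {a u : D} (h : IsValuationAt V a)
    (hu : IsUnit u) : IsValuationAt V (u * a) := by
  obtain ⟨u, rfl⟩ := hu
  refine ⟨by simpa using h.1, h.2.1, fun y hy => ?_⟩
  rw [Units.mul_left_dvd]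
  refine h.2.2 y ?_
  convert V.mul_mem _ _ hy (h.2.1 u) using 1
  have : algebraMap D K u ≠ 0 := by simp
  rw [map_mul]
  field_simp

/-- Any two divisors of `x` are comparable. With `x = b c = a d` one has `a / b = a c / x` and `b /
a = b d / x`, and one of these quotients lies in `V`. -/
theorem IsValuationAt.dvd_or_dvd {V : ValuationSubring K} {a b c x : D} (h : IsValuationAt V x)
    (hx : b * c = x) : a ∣ x → a ∣ b ∨ b ∣ a := by
  rintro ⟨d, hd⟩
  have hx0 : x ≠ 0 := h.1
  have hb : algebraMap D K b ≠ 0 := by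
    rintro h0; apply hx0; rw [← hx, (by simpa using h0 : b = 0), zero_mul]
  have hc : c ≠ 0 := by rintro rfl; simp [hx0.symm] at hx
  have ha : algebraMap D K a ≠ 0 := by
    rintro h0; apply hx0; rw [hd, (by simpa using h0 : a = 0), zero_mul]
  have hd0 : d ≠ 0 := by rintro rfl; simp [hx0] at hd
  have hx' : algebraMap D K b * algebraMap D K c = algebraMap D K x := by rw [← map_mul, hx]
  have hd' : algebraMap D K x = algebraMap D K a * algebraMap D K d := by rw [← map_mul, hd]
  have hc' : algebraMap D K c ≠ 0 := by simpa using hc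
  have hd0' : algebraMap D K d ≠ 0 := by simpa using hd0
  rcases V.mem_or_inv_mem (algebraMap D K a / algebraMap D K b) with hv | hv
  · right
    obtain ⟨w, hw⟩ := h.2.2 (a * c) (by
      convert hv using 1
      rw [map_mul, ← hx']
      field_simp)
    refine ⟨w, mul_right_cancel₀ hc ?_⟩
    rw [hw, ← hx]; ring
  · left
    obtain ⟨w, hw⟩ := h.2.2 (b * d) (by
      convert hv using 1
      rw [map_mul, hd']
      field_simp)
    refine ⟨w, mul_right_cancel₀ hd0 ?_⟩
    rw [hw, hd]; ring

/-- A finite subset `F` of the radical generates an ideal with a power inside `aD`, and powers of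
its `t`-closure stay in the `t`-closure of that power, hence in `aD`. -/
theorem isTIdeal_radical_span {a : D} (ha : a ≠ 0) : IsTIdeal K (Ideal.span {a}).radical := by
  refine isTIdeal_of_tcl_le ?_ ?_
  · intro h
    have : a ∈ (Ideal.span {a}).radical := Ideal.le_radical (Ideal.mem_span_singleton_self a)
    rw [h] at this
    exact ha this
  · rintro x ⟨F, hF, hx⟩
    have hFr : Ideal.span (F : Set D) ≤ (Ideal.span {a}).radical := Ideal.span_le.2 hF
    obtain ⟨k, hk⟩ := Ideal.exists_pow_le_of_le_radical_of_fg hFr ⟨F, rfl⟩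
    have hx' : x ∈ (Ideal.span (F : Set D)).tcl := ⟨F, fun f hf => Ideal.subset_span hf, hx⟩
    refine ⟨k, ?_⟩
    rw [← Ideal.tcl_span_singleton]
    refine Ideal.tcl_mono hk ?_
    rw [← Ideal.tcl_tcl_pow]
    exact Ideal.le_tcl _ (Ideal.pow_mem_pow hx' k)

/-- The radicals of `aD` and `bD` are prime `t`-ideals inside `M`, hence comparable. If `b ∣ a ^ m`,
then `a` and `b` are both divisors of `a ^ (m + 1)`, whose divisors are comparable. -/
theorem IsValuationElement.dvd_or_dvd_of_mem (hD : IsTTreed D K) {a b : D}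
    (ha : IsValuationElement K a) (hb : IsValuationElement K b) {M : Ideal D}
    (hM : IsMaximalTIdeal K M) (haM : a ∈ M) (hbM : b ∈ M) : a ∣ b ∨ b ∣ a := by
  obtain ⟨hua, V, hV⟩ := isValuationElement_iff.1 ha
  obtain ⟨hub, W, hW⟩ := isValuationElement_iff.1 hb
  have hMp := hM.isPrime
  have key : ∀ {V : ValuationSubring K} {a b : D}, IsValuationAt V a →
      (Ideal.span {a}).radical ≤ (Ideal.span {b}).radical → b ∣ a ∨ a ∣ b := by
    intro V a b hV h
    obtain ⟨m, hm⟩ := h (Ideal.le_radical (Ideal.mem_span_singleton_self a))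
    rw [Ideal.mem_span_singleton] at hm
    exact (hV.pow (m + 1)).dvd_or_dvd (pow_succ' a m).symm (hm.trans (pow_dvd_pow a m.le_succ))
  rcases hD _ _ M (hV.isPrime_radical hua) (isTIdeal_radical_span hV.1) (hW.isPrime_radical hub)
    (isTIdeal_radical_span hW.1) hMp hM.isTIdeal
    (hMp.radical_le_iff.2 (by rwa [Ideal.span_singleton_le_iff_mem]))
    (hMp.radical_le_iff.2 (by rwa [Ideal.span_singleton_le_iff_mem])) with h | h
  · exact (key hV h).symm
  · exact key hW h

/-- A valuation element lies in only one maximal `t`-ideal. -/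
theorem IsValuationElement.eq_of_mem {a : D} (ha : IsValuationElement K a) {M N : Ideal D}
    (hM : IsMaximalTIdeal K M) (hN : IsMaximalTIdeal K N) (haM : a ∈ M) (haN : a ∈ N) :
    M = N := by
  classical
  obtain ⟨hua, V, hV⟩ := isValuationElement_iff.1 ha
  have ha0 := hV.1
  have ha' : algebraMap D K a ≠ 0 := by simpa using ha0
  -- zero divisors modulo `a`
  have hzd : ∀ {M : Ideal D}, IsMaximalTIdeal K M → a ∈ M → ∀ s ∈ M, ∃ y, ¬ a ∣ y ∧ a ∣ s * y := by
    intro M hM haM s hs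
    by_contra! hne
    -- An element `s` regular modulo `a` would be `t`-coprime to `a`, so `s` and `a` could not both
    -- lie in `M`.
    refine hM.notMem_of_coprime (a := s) (b := a) (fun e r h1 h2 => ?_) hs haM
    by_cases hr : r = 0
    · rw [hr]; exact dvd_zero e
    obtain ⟨w, hw⟩ := h1
    obtain ⟨y, hy⟩ := h2
    have he : e ≠ 0 := by
      rintro rfl
      rw [zero_mul] at hy
      exact (mul_ne_zero hr ha0) hy
    have hay : a ∣ y := by
      by_contra hay
      refine hne y hay ⟨w, mul_left_cancel₀ he ?_⟩
      linear_combination a * hw - s * hy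
    obtain ⟨z, rfl⟩ := hay
    exact ⟨z, mul_right_cancel₀ ha0 (by rw [hy]; ring)⟩
  -- Annihilators modulo `a` are directed: if `z / y ∈ V`, everything annihilating `y` modulo `a`
  -- annihilates `z`.
  have hdir : ∀ y z : D, ¬ a ∣ y → ¬ a ∣ z → ∃ w, ¬ a ∣ w ∧ (∀ s, a ∣ s * y → a ∣ s * w) ∧
      ∀ s, a ∣ s * z → a ∣ s * w := by
    have key : ∀ y z : D, ¬ a ∣ y → ¬ a ∣ z → algebraMap D K z / algebraMap D K y ∈ V →
        ∀ s, a ∣ s * y → a ∣ s * z := by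
      rintro y z hy hz hv s ⟨w, hw⟩
      refine hV.2.2 _ ?_
      have hy' : algebraMap D K y ≠ 0 := by
        intro h; exact hy ((by simpa using h : y = 0) ▸ dvd_zero a)
      convert V.mul_mem _ _ hv (hV.2.1 w) using 1
      have hw' : algebraMap D K s * algebraMap D K y = algebraMap D K a * algebraMap D K w := by
        rw [← map_mul, ← map_mul, hw]
      rw [map_mul]
      field_simp
      linear_combination algebraMap D K z * hw'
    intro y z hy hz
    rcases V.mem_or_inv_mem (algebraMap D K z / algebraMap D K y) with hv | hv
    · exact ⟨z, hz, key y z hy hz hv, fun _ h => h⟩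
    · rw [inv_div] at hv
      exact ⟨y, hy, fun _ h => h, key z y hz hy hv⟩
  by_contra hne
  -- Distinct `M`, `N` have `(M + N)_t = D`, witnessed by a finite set `F`. By directedness all of
  -- `F` annihilates a single `y` with `a ∤ y`; but then `1 ∈ F_t` gives `a ∣ y`.
  have hsup : (M ⊔ N).tcl = ⊤ := by
    obtain ⟨x, hx, hxN⟩ := hM.exists_notMem hN hne
    exact hN.tcl_eq_top (lt_of_le_of_ne le_sup_right fun h => hxN (h ▸ Ideal.mem_sup_left hx))
  obtain ⟨F, hF, h1⟩ := (hsup ▸ Submodule.mem_top : (1 : D) ∈ (M ⊔ N).tcl)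
  have key : ∀ G : Finset D, (∀ f ∈ G, f ∈ M ⊔ N) → ∃ y, ¬ a ∣ y ∧ ∀ f ∈ G, a ∣ f * y := by
    intro G
    induction G using Finset.induction_on with
    | empty => exact fun _ => ⟨1, fun h => hua (isUnit_of_dvd_one h), by simp⟩
    | insert f G _ ih =>
      intro hG
      obtain ⟨y, hy, hyG⟩ := ih fun g hg => hG g (Finset.mem_insert_of_mem hg)
      obtain ⟨m, hm, n, hn, rfl⟩ := Submodule.mem_sup.1 (hG f (Finset.mem_insert_self f G))
      obtain ⟨z₁, hz₁, h₁⟩ := hzd hM haM m hm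
      obtain ⟨z₂, hz₂, h₂⟩ := hzd hN haN n hn
      obtain ⟨w, hw, h₃, h₄⟩ := hdir z₁ z₂ hz₁ hz₂
      obtain ⟨v, hv, h₅, h₆⟩ := hdir y w hy hw
      refine ⟨v, hv, fun g hg => ?_⟩
      rcases Finset.mem_insert.1 hg with rfl | hg
      · rw [add_mul]
        exact dvd_add (h₆ _ (h₃ _ h₁)) (h₆ _ (h₄ _ h₂))
      · exact h₅ _ (hyG g hg)
  obtain ⟨y, hy, hyF⟩ := key F hF
  refine hy ?_
  have := h1 a y fun f hf => by rw [mul_comm]; exact hyF f hf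
  rwa [mul_one] at this

/-- The localization of `D` at `M` is a valuation ring. -/
def IsLocallyValuation (M : Ideal D) : Prop := ∀ x y : D, ∃ s ∉ M, x ∣ s * y ∨ y ∣ s * x

variable (K) in
/-- The localization at a prime `M` as a valuation subring of the quotient field. -/
def valuationSubringAt (M : Ideal D) (hM : M.IsPrime) (h : IsLocallyValuation M) :
    ValuationSubring K where
  carrier := {z | ∃ s ∉ M, ∃ d : D, algebraMap D K s * z = algebraMap D K d}
  mul_mem' := by
    rintro x y ⟨s, hs, c, hc⟩ ⟨t, ht, d, hd⟩
    exact ⟨s * t, hM.mul_notMem hs ht, c * d, by rw [map_mul, map_mul, ← hc, ← hd]; ring⟩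
  one_mem' := ⟨1, (Ideal.ne_top_iff_one M).1 hM.ne_top, 1, by simp⟩
  add_mem' := by
    rintro x y ⟨s, hs, c, hc⟩ ⟨t, ht, d, hd⟩
    exact ⟨s * t, hM.mul_notMem hs ht, t * c + s * d, by
      rw [map_add, map_mul, map_mul, map_mul, ← hc, ← hd]; ring⟩
  zero_mem' := ⟨1, (Ideal.ne_top_iff_one M).1 hM.ne_top, 0, by simp⟩
  neg_mem' := by
    rintro x ⟨s, hs, c, hc⟩
    exact ⟨s, hs, -c, by rw [map_neg, ← hc]; ring⟩
  mem_or_inv_mem' := by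
    intro z
    obtain ⟨x, y, hy, rfl⟩ := IsFractionRing.div_surjective (A := D) z
    have hy0 : algebraMap D K y ≠ 0 := by simpa using nonZeroDivisors.ne_zero hy
    obtain ⟨s, hs, ⟨d, hd⟩ | ⟨d, hd⟩⟩ := h x y
    · right
      by_cases hx : x = 0
      · exact ⟨1, (Ideal.ne_top_iff_one M).1 hM.ne_top, 0, by simp [hx]⟩
      · have hx0 : algebraMap D K x ≠ 0 := by simpa using hx
        refine ⟨s, hs, d, ?_⟩
        rw [inv_div, ← mul_div_assoc, div_eq_iff hx0, ← map_mul, hd, map_mul, mul_comm]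
    · left
      refine ⟨s, hs, d, ?_⟩
      rw [← mul_div_assoc, div_eq_iff hy0, ← map_mul, hd, map_mul, mul_comm]

theorem mem_valuationSubringAt {M : Ideal D} {hM : M.IsPrime} {h : IsLocallyValuation M} {z : K} :
    z ∈ valuationSubringAt K M hM h ↔ ∃ s ∉ M, ∃ d : D, algebraMap D K s * z = algebraMap D K d :=
  Iff.rfl

theorem algebraMap_mem_valuationSubringAt {M : Ideal D} (hM : M.IsPrime)
    (h : IsLocallyValuation M) (d : D) : algebraMap D K d ∈ valuationSubringAt K M hM h :=
  ⟨1, (Ideal.ne_top_iff_one M).1 hM.ne_top, d, by simp⟩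

theorem div_mem_valuationSubringAt {M : Ideal D} {hM : M.IsPrime} {h : IsLocallyValuation M}
    {a y : D} (ha : a ≠ 0) :
    algebraMap D K y / algebraMap D K a ∈ valuationSubringAt K M hM h ↔ ∃ s ∉ M, a ∣ s * y := by
  have ha' : algebraMap D K a ≠ 0 := by simpa using ha
  rw [mem_valuationSubringAt]
  refine exists_congr fun s => and_congr_right fun _ => exists_congr fun d => ?_
  rw [← mul_div_assoc, div_eq_iff ha', ← map_mul, ← map_mul, mul_comm d]
  exact (IsFractionRing.injective D K).eq_iff

/-- Divisibility by `d` needs testing only at `M`, where `d` is not locally a unit; so the valuation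
ring `D_M` itself serves as `V`. -/
theorem isValuationElement_of_unique {M : Ideal D} (hM : IsMaximalTIdeal K M)
    (h : IsLocallyValuation M) {d : D} (hd : d ≠ 0) (hu : ¬ IsUnit d)
    (hN : ∀ N, IsMaximalTIdeal K N → N ≠ M → d ∉ N) : IsValuationElement K d := by
  refine isValuationElement_iff.2 ⟨hu, valuationSubringAt K M hM.isPrime h, hd,
    algebraMap_mem_valuationSubringAt _ _, fun y hy => ?_⟩
  rw [div_mem_valuationSubringAt hd] at hy
  refine dvd_of_forall_isMaximalTIdeal K hd fun N hN' => ?_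
  by_cases hNM : N = M
  · rwa [hNM]
  · exact ⟨d, hN N hN' hNM, dvd_mul_right d y⟩

theorem isAVFD_iff : IsAVFD D K ↔ ∀ x : D, x ≠ 0 → IsAlmostVF K x := by
  constructor
  · intro h x hx
    by_cases hu : IsUnit x
    · exact hu.isAlmostVF
    · obtain ⟨n, hn, s, hs, h⟩ := h x hx hu
      exact ⟨n, hn, 1, isUnit_one, s, hs, by rw [one_mul, h]⟩
  · intro h x hx hu
    obtain ⟨n, hn, u, huu, s, hs, hx⟩ := h x hx
    refine ⟨n, hn, ?_⟩
    -- The unit is absorbed into one of the valuation elements; an empty product would make `x` a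
    -- unit.
    rcases Multiset.empty_or_exists_mem s with rfl | ⟨v, hv⟩
    · rw [Multiset.prod_zero, mul_one] at hx
      exact absurd ((isUnit_pow_iff hn.ne').1 (hx ▸ huu)) hu
    · obtain ⟨t, rfl⟩ := Multiset.exists_cons_of_mem hv
      refine ⟨(u * v) ::ₘ t, fun w hw => ?_, by rw [hx, Multiset.prod_cons, Multiset.prod_cons,
        mul_assoc]⟩
      rcases Multiset.mem_cons.1 hw with rfl | hw
      · obtain ⟨hv', V, hV⟩ := isValuationElement_iff.1 (hs v hv)
        exact isValuationElement_iff.2 ⟨fun h => hv' (isUnit_of_mul_isUnit_right h), V,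
          hV.mul_unit huu⟩
      · exact hs w (Multiset.mem_cons_of_mem hw)

end ValuationElements

/-! ### Domains with valuation localizations at maximal `t`-ideals -/

section LocallyValuation

variable {D : Type*} [CommRing D]

/-- Lets the exponents obtained separately at finitely many maximal `t`-ideals be replaced by one.
-/
theorem Finset.exists_common_exponent {ι : Type*} (S : Finset ι) {P : ι → ℕ → Prop}
    (hP : ∀ i ∈ S, ∀ n k, 0 < k → P i n → P i (n * k)) (h : ∀ i ∈ S, ∃ n, 0 < n ∧ P i n) :
    ∃ n, 0 < n ∧ ∀ i ∈ S, P i n := by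
  classical
  induction S using Finset.induction_on with
  | empty => exact ⟨1, one_pos, by simp⟩
  | insert i S _ ih =>
    obtain ⟨n, hn, h1⟩ := ih
      (fun j hj => hP j (Finset.mem_insert_of_mem hj)) fun j hj => h j (Finset.mem_insert_of_mem hj)
    obtain ⟨m, hm, h2⟩ := h i (Finset.mem_insert_self i S)
    refine ⟨n * m, Nat.mul_pos hn hm, fun j hj => ?_⟩
    have hPj := hP j hj
    rcases Finset.mem_insert.1 hj with rfl | hj
    · rw [mul_comm]; exact hPj _ _ hn h2
    · exact hPj _ _ hm (h1 j hj)

theorem IsLocallyValuation.exists_dvd {M : Ideal D} (hM : M.IsPrime) (h : IsLocallyValuation M)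
    (F : Finset D) (hF : F.Nonempty) : ∃ i ∈ F, ∃ s ∉ M, ∀ j ∈ F, i ∣ s * j := by
  classical
  induction hF using Finset.Nonempty.cons_induction with
  | singleton a =>
    exact ⟨a, by simp, 1, (Ideal.ne_top_iff_one M).1 hM.ne_top, by simp⟩
  | cons a F _ _ ih =>
    obtain ⟨i, hi, s, hs, hij⟩ := ih
    obtain ⟨t, ht, hat | hit⟩ := h a i
    · refine ⟨a, by simp, t * s, hM.mul_notMem ht hs, fun j hj => ?_⟩
      rcases Finset.mem_cons.1 hj with rfl | hj
      · exact dvd_mul_left _ _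
      · rw [mul_assoc]
        exact hat.trans (mul_dvd_mul_left t (hij j hj))
    · refine ⟨i, by simp [hi], t * s, hM.mul_notMem ht hs, fun j hj => ?_⟩
      rcases Finset.mem_cons.1 hj with rfl | hj
      · rw [mul_right_comm]; exact hit.mul_right s
      · rw [mul_assoc]; exact (hij j hj).mul_left t

variable [IsDomain D] {K : Type*} [Field K] [Algebra D K] [IsFractionRing D K]

theorem isPvMD_of_isLocallyValuation
    (h : ∀ M : Ideal D, IsMaximalTIdeal K M → IsLocallyValuation M) : IsPvMD D K := by
  rintro I hI ⟨F, rfl⟩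
  refine (isTInvertible_coeIdeal_iff hI).2 fun M hM => ?_
  have hF : F.Nonempty := by
    rw [Finset.nonempty_iff_ne_empty]
    rintro rfl
    simp at hI
  obtain ⟨i, hi, s, hs, hij⟩ := (h M hM).exists_dvd hM.isPrime F hF
  refine ⟨i, Ideal.subset_span hi, s, hs, fun j hj => ?_⟩
  have : Ideal.span (F : Set D) ≤ Submodule.comap (LinearMap.mulLeft D s) (Ideal.span {i}) :=
    Ideal.span_le.2 fun f hf => Ideal.mem_span_singleton.2 (hij f hf)
  exact Ideal.mem_span_singleton.1 (this hj)

/-- Let `i = α x + β y` generate `(x, y)` locally, with `s x = i c` and `s y = i d`. Then `s = α c +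
β d ∉ M` forces `c ∉ M` or `d ∉ M`, and `x d = y c` gives the divisibility. -/
theorem IsPvMD.isLocallyValuation (h : IsPvMD D K) {M : Ideal D} (hM : IsMaximalTIdeal K M) :
    IsLocallyValuation M := by
  classical
  intro x y
  by_cases hI : Ideal.span {x, y} = ⊥
  · have hx : x = 0 := by
      have : x ∈ Ideal.span {x, y} := Ideal.subset_span (by simp)
      simpa [hI] using this
    exact ⟨1, (Ideal.ne_top_iff_one M).1 hM.ne_top, Or.inr (by simp [hx])⟩
  · obtain ⟨i, hi, s, hs, hij⟩ := (isTInvertible_coeIdeal_iff hI).1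
      (h (Ideal.span {x, y}) hI ⟨{x, y}, by simp⟩) M hM
    have hs0 : s ≠ 0 := fun h => hs (h ▸ M.zero_mem)
    have hi0 : i ≠ 0 := by
      rintro rfl
      refine hI ((Submodule.eq_bot_iff _).2 fun j hj => ?_)
      exact (mul_eq_zero.1 (zero_dvd_iff.1 (hij j hj))).resolve_left hs0
    obtain ⟨c, hc⟩ := hij x (Ideal.subset_span (by simp))
    obtain ⟨d, hd⟩ := hij y (Ideal.subset_span (by simp))
    obtain ⟨α, β, rfl⟩ := Ideal.mem_span_pair.1 hi
    set i := α * x + β * y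
    have hscd : s = α * c + β * d := mul_left_cancel₀ hi0 (by
      simp only [i] at hc hd ⊢
      linear_combination α * hc + β * hd)
    by_cases hcM : c ∈ M
    · have hdM : d ∉ M := fun hdM => hs (hscd ▸
        M.add_mem (M.mul_mem_left _ hcM) (M.mul_mem_left _ hdM))
      exact ⟨d, hdM, Or.inr ⟨c, mul_left_cancel₀ hi0 (by linear_combination y * hc - x * hd)⟩⟩
    · exact ⟨c, hcM, Or.inl ⟨d, mul_left_cancel₀ hi0 (by linear_combination x * hd - y * hc)⟩⟩

/-- Over the valuation ring `D_M` a finite subset of `P` is generated by one of its elements, so its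
`t`-closure stays in `P` up to factors outside `M ⊇ P`. -/
theorem isTIdeal_of_le_isLocallyValuation {P M : Ideal D} (hP : P.IsPrime) (h0 : P ≠ ⊥)
    (hPM : P ≤ M) (hM : M.IsPrime) (h : IsLocallyValuation M) : IsTIdeal K P := by
  refine isTIdeal_of_tcl_le h0 ?_
  rintro x ⟨F, hF, hx⟩
  rcases F.eq_empty_or_nonempty with rfl | hne
  · have := hx 0 1 (by simp)
    rw [one_mul, zero_dvd_iff] at this
    rw [this]; exact P.zero_mem
  · obtain ⟨i, hi, s, hs, hij⟩ := h.exists_dvd hM F hne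
    exact (hP.mem_or_mem (P.mem_of_dvd (hx i s hij) (hF i hi))).resolve_left fun h => hs (hPM h)

/-- `D` is the intersection of the valuation rings `D_M`, each integrally closed. -/
theorem isIntegrallyClosed_of_isLocallyValuation
    (h : ∀ M : Ideal D, IsMaximalTIdeal K M → IsLocallyValuation M) : IsIntegrallyClosed D := by
  rw [isIntegrallyClosed_iff K]
  intro x hx
  obtain ⟨a, b, hb, rfl⟩ := IsFractionRing.div_surjective (A := D) x
  have hb0 := nonZeroDivisors.ne_zero hb
  have hdvd : b ∣ a := by
    refine dvd_of_forall_isMaximalTIdeal K hb0 fun M hM => ?_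
    rw [← div_mem_valuationSubringAt (K := K) (hM := hM.isPrime) (h := h M hM) hb0]
    set V := valuationSubringAt K M hM.isPrime (h M hM)
    obtain ⟨p, hp, hpx⟩ := hx
    have hx' : IsIntegral V (algebraMap D K a / algebraMap D K b) := by
      let φ : D →+* V := (algebraMap D K).codRestrict V.toSubring
        (algebraMap_mem_valuationSubringAt _ _)
      refine ⟨p.map φ, hp.map φ, ?_⟩
      rw [Polynomial.eval₂_map]
      exact hpx
    obtain ⟨v, hv⟩ := IsIntegrallyClosed.isIntegral_iff.1 hx'
    rw [← hv]
    exact v.2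
  obtain ⟨c, rfl⟩ := hdvd
  exact ⟨c, by rw [map_mul, mul_div_cancel_left₀ _ (by simpa using hb0)]⟩

end LocallyValuation

/-! ### Consequences of every nonzero prime containing a valuation element -/

section WeaklyMatlis

variable {D : Type*} [CommRing D] {K : Type*} [Field K] [Algebra D K]

/-- Kaplansky's argument: otherwise `xD` misses the multiplicative set generated by the valuation
elements, and so does some prime containing `x`. -/
theorem exists_dvd_mem_closure_isValuationElement
    (h : ∀ P : Ideal D, P.IsPrime → P ≠ ⊥ → ∃ a ∈ P, IsValuationElement K a) {x : D} (hx : x ≠ 0) :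
    ∃ y ∈ Submonoid.closure {v : D | IsValuationElement K v}, x ∣ y := by
  by_contra! hne
  obtain ⟨P, hP, hxP, hdis⟩ := Ideal.exists_le_prime_disjoint (Ideal.span {x})
    (Submonoid.closure {v : D | IsValuationElement K v}) (Set.disjoint_left.2 fun y hy hy' =>
      hne y hy' (Ideal.mem_span_singleton.1 hy))
  obtain ⟨a, ha, hav⟩ := h P hP (by
    rintro rfl
    exact hx (by simpa using hxP))
  exact Set.disjoint_left.1 hdis ha (Submonoid.subset_closure hav)

variable [IsDomain D] [IsFractionRing D K]

theorem finite_isMaximalTIdeal_of_mem_closure {y : D}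
    (hy : y ∈ Submonoid.closure {v : D | IsValuationElement K v}) :
    {M : Ideal D | IsMaximalTIdeal K M ∧ y ∈ M}.Finite := by
  induction hy using Submonoid.closure_induction with
  | mem x hx =>
    exact Set.Subsingleton.finite fun M hM N hN => hx.eq_of_mem hM.1 hN.1 hM.2 hN.2
  | one =>
    refine Set.finite_empty.subset ?_
    rintro M ⟨hM, h1⟩
    exact hM.ne_top ((Ideal.eq_top_iff_one M).2 h1)
  | mul x y _ _ hx hy =>
    refine (hx.union hy).subset ?_
    rintro M ⟨hM, h⟩
    exact (hM.isPrime.mem_or_mem h).imp (fun h => ⟨hM, h⟩) fun h => ⟨hM, h⟩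

theorem isWeaklyMatlis_of_forall_exists_isValuationElement
    (h : ∀ P : Ideal D, P.IsPrime → P ≠ ⊥ → ∃ a ∈ P, IsValuationElement K a) :
    IsWeaklyMatlis D K := by
  constructor
  · intro a ha _
    obtain ⟨y, hy, hay⟩ := exists_dvd_mem_closure_isValuationElement h ha
    exact (finite_isMaximalTIdeal_of_mem_closure hy).subset fun M hM =>
      ⟨hM.1, M.mem_of_dvd hay hM.2⟩
  · intro P hP hPt
    obtain ⟨a, haP, ha⟩ := h P hP hPt.1
    obtain ⟨M, hM, hPM⟩ := exists_isMaximalTIdeal_ge K hPt.1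
      (by rw [((isTIdeal_iff P).1 hPt).2]; exact hP.ne_top)
    exact ⟨M, ⟨hM, hPM⟩, fun N hN => ha.eq_of_mem hN.1 hM (hN.2 haP) (hPM haP)⟩

/-- Locally at `M`, a product of valuation elements divides a single element with the valuation
property: factors outside `M` go into `t`, and of two factors in `M` one divides the other, so their
product divides the square of the larger. -/
theorem exists_isValuationAt_of_mem_closure (hD : IsTTreed D K) {M : Ideal D}
    (hM : IsMaximalTIdeal K M) {y : D}
    (hy : y ∈ Submonoid.closure {v : D | IsValuationElement K v}) :
    ∃ (V : ValuationSubring K) (a : D), IsValuationAt V a ∧ ∃ t ∉ M, y ∣ t * a := by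
  have h1 : (1 : D) ∉ M := (Ideal.ne_top_iff_one M).1 hM.ne_top
  induction hy using Submonoid.closure_induction with
  | mem x hx =>
    obtain ⟨-, V, hV⟩ := isValuationElement_iff.1 hx
    exact ⟨V, x, hV, 1, h1, by simp⟩
  | one =>
    exact ⟨⊤, 1, ⟨one_ne_zero, fun _ => ValuationSubring.mem_top _, fun y _ => one_dvd y⟩, 1, h1,
      by simp⟩
  | mul x y _ _ hx hy =>
    obtain ⟨V, a, hV, t, ht, hxt⟩ := hx
    obtain ⟨W, b, hW, r, hr, hyr⟩ := hy
    have hxy := mul_dvd_mul hxt hyr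
    by_cases ha : a ∈ M
    · by_cases hb : b ∈ M
      · have hunit : ∀ {c}, c ∈ M → ¬ IsUnit c := fun hc hu =>
          hM.ne_top (Ideal.eq_top_of_isUnit_mem M hc hu)
        rcases (isValuationElement_iff.2 ⟨hunit ha, V, hV⟩).dvd_or_dvd_of_mem hD
          (isValuationElement_iff.2 ⟨hunit hb, W, hW⟩) hM ha hb with hab | hab
        · refine ⟨W, b ^ 2, hW.pow 2, t * r, hM.isPrime.mul_notMem ht hr, hxy.trans ?_⟩
          rw [mul_mul_mul_comm, sq]
          exact mul_dvd_mul_left _ (mul_dvd_mul_right hab b)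
        · refine ⟨V, a ^ 2, hV.pow 2, t * r, hM.isPrime.mul_notMem ht hr, hxy.trans ?_⟩
          rw [mul_mul_mul_comm, sq]
          exact mul_dvd_mul_left _ (mul_dvd_mul_left a hab)
      · refine ⟨V, a, hV, t * (r * b), hM.isPrime.mul_notMem ht (hM.isPrime.mul_notMem hr hb),
          hxy.trans (dvd_of_eq (by ring))⟩
    · refine ⟨W, b, hW, t * a * r, hM.isPrime.mul_notMem (hM.isPrime.mul_notMem ht ha) hr,
          hxy.trans (dvd_of_eq (by ring))⟩

theorem isLocallyValuation_of_forall_exists_isValuationElement (hD : IsTTreed D K)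
    (h : ∀ P : Ideal D, P.IsPrime → P ≠ ⊥ → ∃ a ∈ P, IsValuationElement K a) {M : Ideal D}
    (hM : IsMaximalTIdeal K M) : IsLocallyValuation M := by
  intro x y
  have h1 : (1 : D) ∉ M := (Ideal.ne_top_iff_one M).1 hM.ne_top
  by_cases hxy : x * y = 0
  · rcases mul_eq_zero.1 hxy with rfl | rfl
    · exact ⟨1, h1, Or.inr (by simp)⟩
    · exact ⟨1, h1, Or.inl (by simp)⟩
  obtain ⟨z, hz, hxyz⟩ := exists_dvd_mem_closure_isValuationElement h hxy
  obtain ⟨V, a, hV, t, ht, hzt⟩ := exists_isValuationAt_of_mem_closure hD hM hz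
  have hxt := ((dvd_mul_right x y).trans hxyz).trans hzt
  have hyt := ((dvd_mul_left y x).trans hxyz).trans hzt
  have ha := hV.1
  have ha' : algebraMap D K a ≠ 0 := by simpa using ha
  -- With `t a = x w` one has `y w / a = t (y / x) ∈ V`. Hence `a ∣ y w`, and cancelling `a` gives
  -- `x ∣ t y`.
  have key : ∀ x y : D, x ≠ 0 → x ∣ t * a → algebraMap D K y / algebraMap D K x ∈ V →
      x ∣ t * y := by
    rintro x y hx ⟨w, hw⟩ hv
    have hx' : algebraMap D K x ≠ 0 := by simpa using hx
    have hw' : algebraMap D K t * algebraMap D K a = algebraMap D K x * algebraMap D K w := by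
      rw [← map_mul, ← map_mul, hw]
    obtain ⟨d, hd⟩ := hV.2.2 (y * w) (by
      convert V.mul_mem _ _ hv (hV.2.1 t) using 1
      rw [map_mul]
      field_simp
      linear_combination -algebraMap D K y * hw')
    exact ⟨d, mul_right_cancel₀ ha (by linear_combination y * hw + x * hd)⟩
  refine ⟨t, ht, ?_⟩
  rcases V.mem_or_inv_mem (algebraMap D K y / algebraMap D K x) with hv | hv
  · exact Or.inl (key x y (left_ne_zero_of_mul hxy) hxt hv)
  · rw [inv_div] at hv
    exact Or.inr (key y x (right_ne_zero_of_mul hxy) hyt hv)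

theorem IsWeaklyMatlis.finite (h : IsWeaklyMatlis D K) {a : D} (ha : a ≠ 0) :
    {M : Ideal D | IsMaximalTIdeal K M ∧ a ∈ M}.Finite := by
  by_cases hu : IsUnit a
  · refine Set.finite_empty.subset ?_
    rintro M ⟨hM, h⟩
    exact hM.ne_top (Ideal.eq_top_of_isUnit_mem M h hu)
  · exact h.1 a ha hu

theorem dvd_of_notMem_of_ne {M : Ideal D} {c y : D} (hc : c ≠ 0)
    (hcN : ∀ N, IsMaximalTIdeal K N → N ≠ M → c ∉ N) (h : ∃ s ∉ M, c ∣ s * y) : c ∣ y := by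
  refine dvd_of_forall_isMaximalTIdeal K hc fun N hN => ?_
  by_cases hNM : N = M
  · rwa [hNM]
  · exact ⟨c, hcN N hN hNM, dvd_mul_right c y⟩

theorem IsMaximalTIdeal.prod_notMem {ι : Type*} {N : Ideal D} (hN : IsMaximalTIdeal K N)
    {S : Finset ι} {c : ι → D} (h : ∀ M ∈ S, c M ∉ N) : ∏ M ∈ S, c M ∉ N := by
  have := hN.isPrime
  rw [Ideal.IsPrime.prod_mem_iff]
  push Not
  exact h

/-- At each maximal `t`-ideal at most one of the factors is not a local unit. -/
theorem prod_dvd_of_notMem_of_ne {S : Finset (Ideal D)} {c : Ideal D → D} {y : D}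
    (hc : ∀ M ∈ S, c M ≠ 0) (hcN : ∀ M ∈ S, ∀ N, IsMaximalTIdeal K N → N ≠ M → c M ∉ N)
    (h : ∀ M ∈ S, c M ∣ y) : ∏ M ∈ S, c M ∣ y := by
  classical
  refine dvd_of_forall_isMaximalTIdeal K (Finset.prod_ne_zero_iff.2 hc) fun N hN => ?_
  by_cases hNS : N ∈ S
  · refine ⟨∏ M ∈ S.erase N, c M, hN.prod_notMem fun M hM => ?_, ?_⟩
    · exact hcN M (Finset.mem_of_mem_erase hM) N hN (Finset.ne_of_mem_erase hM).symm
    · rw [← Finset.prod_erase_mul S c hNS]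
      exact mul_dvd_mul_left _ (h N hNS)
  · refine ⟨∏ M ∈ S, c M, hN.prod_notMem fun M hM => ?_, dvd_mul_right _ y⟩
    exact hcN M hM N hN fun h => hNS (h ▸ hM)

end WeaklyMatlis

/-! ### Almost GCD domains -/

section AlmostGCD

/-- The lcm `m` and the gcd `d` of `x = a ^ n` and `y = b ^ n` determine each other by `m d = x y`.
The extra factor `s` makes the gcd stable under scaling, so that `dD` is the `v`-closure of `(x,
y)`. -/
theorem isAGCD_iff {D : Type*} [CommRing D] [IsDomain D] :
    IsAGCD D ↔ ∀ a b : D, a ≠ 0 → ∃ n : ℕ, 0 < n ∧ ∃ d, d ∣ a ^ n ∧ d ∣ b ^ n ∧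
      ∀ e s, e ∣ s * a ^ n → e ∣ s * b ^ n → e ∣ s * d := by
  constructor
  · intro h a b ha
    by_cases hb : b = 0
    · exact ⟨1, one_pos, a, by simp, by simp [hb], fun e s h _ => by simpa using h⟩
    obtain ⟨n, hn, m, hm⟩ := h a b
    refine ⟨n, hn, ?_⟩
    have hx : a ^ n ≠ 0 := pow_ne_zero n ha
    have hy : b ^ n ≠ 0 := pow_ne_zero n hb
    generalize a ^ n = x at *
    generalize b ^ n = y at *
    have hmem : ∀ z, x ∣ z ∧ y ∣ z ↔ m ∣ z := by
      intro z
      have : z ∈ (Ideal.span {x} : Ideal D) ⊓ Ideal.span {y} ↔ z ∈ Ideal.span {m} := by rw [hm]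
      simpa only [Ideal.mem_inf, Ideal.mem_span_singleton] using this
    obtain ⟨d, hd⟩ := (hmem (x * y)).1 ⟨dvd_mul_right x y, dvd_mul_left y x⟩
    have hm0 : m ≠ 0 := by rintro rfl; exact mul_ne_zero hx hy (by simpa using hd)
    obtain ⟨⟨p, hp⟩, ⟨q, hq⟩⟩ := (hmem m).2 dvd_rfl
    refine ⟨d, ⟨q, mul_left_cancel₀ hy (by linear_combination hd + d * hq)⟩,
      ⟨p, mul_left_cancel₀ hx (by linear_combination hd + d * hp)⟩, ?_⟩
    rintro e s ⟨f, hf⟩ ⟨g, hg⟩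
    by_cases he : e = 0
    · subst he
      have : s = 0 := by simpa [hx] using hf
      simp [this]
    obtain ⟨w, hw⟩ := (hmem (f * y)).1
      ⟨⟨g, mul_left_cancel₀ he (by linear_combination x * hg - y * hf)⟩, dvd_mul_left _ _⟩
    exact ⟨w, mul_left_cancel₀ hm0 (by linear_combination e * hw + y * hf - s * hd)⟩
  · intro h a b
    by_cases ha : a = 0
    · exact ⟨1, one_pos, 0, by simp [ha]⟩
    obtain ⟨n, hn, d, ⟨p, hp⟩, ⟨q, hq⟩, hd⟩ := h a b ha
    refine ⟨n, hn, p * q * d, ?_⟩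
    have hx : a ^ n ≠ 0 := pow_ne_zero n ha
    generalize a ^ n = x at *
    generalize b ^ n = y at *
    have hd0 : d ≠ 0 := by rintro rfl; simp [hx] at hp
    refine le_antisymm (fun z hz => ?_) ?_
    · rw [Ideal.mem_inf, Ideal.mem_span_singleton, Ideal.mem_span_singleton] at hz
      refine Ideal.mem_span_singleton.2 ?_
      obtain ⟨⟨f, hf⟩, ⟨g, hg⟩⟩ := hz
      obtain ⟨w, hw⟩ := hd (x * y) z ⟨g, by linear_combination x * hg⟩
        ⟨f, by linear_combination y * hf⟩
      refine ⟨w, mul_right_cancel₀ hd0 ?_⟩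
      rw [hw, hp, hq]; ring
    · rw [Submodule.span_singleton_le_iff_mem, Ideal.mem_inf, Ideal.mem_span_singleton,
        Ideal.mem_span_singleton]
      exact ⟨⟨q, by rw [hp]; ring⟩, ⟨p, by rw [hq]; ring⟩⟩

variable {D : Type*} [CommRing D] [IsDomain D] {K : Type*} [Field K] [Algebra D K]
  [IsFractionRing D K]

/-- Write `x ^ n = d p`, `y ^ n = d q` with `p`, `q` `t`-coprime, so that one of them, say `p`, is
outside `M`. Then `(p y / x) ^ n = p ^ (n - 1) q ∈ D`, and integral closedness gives `x ∣ p y`. -/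
theorem IsAGCD.isLocallyValuation (h : IsAGCD D) [IsIntegrallyClosed D] {M : Ideal D}
    (hM : IsMaximalTIdeal K M) : IsLocallyValuation M := by
  have h1 : (1 : D) ∉ M := (Ideal.ne_top_iff_one M).1 hM.ne_top
  have key : ∀ x y p q d : D, ∀ n : ℕ, x ≠ 0 → d ≠ 0 → 0 < n → x ^ n = d * p → y ^ n = d * q →
      p ∉ M → ∃ s ∉ M, x ∣ s * y := by
    intro x y p q d n hx hd hn hp hq hpM
    have hx' : algebraMap D K x ≠ 0 := by simpa using hx
    have h2 : (algebraMap D K (p * y) / algebraMap D K x) ^ n =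
        algebraMap D K (p ^ (n - 1) * q) := by
      rw [div_pow, div_eq_iff (pow_ne_zero n hx'), ← map_pow, ← map_pow, ← map_mul, mul_pow, hp, hq]
      congr 1
      obtain ⟨m, rfl⟩ := Nat.exists_eq_succ_of_ne_zero hn.ne'
      simp only [Nat.succ_eq_add_one, Nat.add_sub_cancel, pow_succ]
      ring
    have h3 : IsIntegral D (algebraMap D K (p * y) / algebraMap D K x) :=
      IsIntegral.of_pow hn (h2 ▸ isIntegral_algebraMap)
    obtain ⟨w, hw⟩ := IsIntegrallyClosed.isIntegral_iff.1 h3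
    refine ⟨p, hpM, w, IsFractionRing.injective D K ?_⟩
    rw [eq_div_iff hx'] at hw
    rw [← hw, map_mul, mul_comm]
  intro x y
  by_cases hx : x = 0
  · exact ⟨1, h1, Or.inr (by simp [hx])⟩
  by_cases hy : y = 0
  · exact ⟨1, h1, Or.inl (by simp [hy])⟩
  obtain ⟨n, hn, d, ⟨p, hp⟩, ⟨q, hq⟩, hd⟩ := isAGCD_iff.1 h x y hx
  have hd0 : d ≠ 0 := by rintro rfl; exact pow_ne_zero n hx (by simpa using hp)
  by_cases hpM : p ∈ M
  · have hqM : q ∉ M := by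
      refine hM.notMem_of_coprime (fun e s h1 h2 => ?_) hpM
      refine (mul_dvd_mul_iff_right hd0).1 (hd (e * d) s ?_ ?_)
      · rw [hp]
        obtain ⟨w, hw⟩ := h1
        exact ⟨w, by linear_combination d * hw⟩
      · rw [hq]
        obtain ⟨w, hw⟩ := h2
        exact ⟨w, by linear_combination d * hw⟩
    obtain ⟨s, hs, h⟩ := key y x q p d n hy hd0 hn hq hp hqM
    exact ⟨s, hs, Or.inr h⟩
  · obtain ⟨s, hs, h⟩ := key x y p q d n hx hd0 hn hp hq hpM
    exact ⟨s, hs, Or.inl h⟩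

/-- Torsion gives `((a, b) ^ n)_t = dD`, and `d` is the gcd of `a ^ n` and `b ^ n`: locally `a` or
`b` generates `(a, b)`, hence its `n`-th power generates `(a, b) ^ n`. -/
theorem isAGCD_of_isPvMD_of_isMulTorsion (h : IsPvMD D K) (ht : IsMulTorsion (TClassGroup D K)) :
    IsAGCD D := by
  classical
  refine isAGCD_iff.2 fun a b ha => ?_
  have haI : a ∈ Ideal.span {a, b} := Ideal.subset_span (by simp)
  have hbI : b ∈ Ideal.span {a, b} := Ideal.subset_span (by simp)
  have hI : Ideal.span {a, b} ≠ ⊥ := fun h => ha (by simpa [h] using haI)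
  obtain ⟨n, hn, d, hd, hnd⟩ := exists_tcl_pow_eq_span ht (h (Ideal.span {a, b}) hI ⟨{a, b}, by simp⟩)
  have hdvd : ∀ x ∈ Ideal.span {a, b} ^ n, d ∣ x := fun x hx => by
    rw [← Ideal.mem_span_singleton, ← hnd]
    exact Ideal.le_tcl _ hx
  refine ⟨n, hn, d, hdvd _ (Ideal.pow_mem_pow haI n), hdvd _ (Ideal.pow_mem_pow hbI n), ?_⟩
  intro e s hea heb
  by_cases he : e = 0
  · subst he
    have : s = 0 := by simpa [ha] using hea
    simp [this]
  have hdmem : d ∈ (Ideal.span {a, b} ^ n).tcl := hnd ▸ Ideal.mem_span_singleton_self d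
  refine dvd_of_forall_isMaximalTIdeal K he fun M hM => ?_
  have key : ∀ x y r : D, y ∈ Ideal.span {a, b} → Ideal.span {a, b} = Ideal.span {x, y} →
      x ∣ r * y → ∀ z ∈ Ideal.span {a, b} ^ n, x ^ n ∣ r ^ n * z := by
    intro x y r hy hxy hr z hz
    refine Ideal.pow_dvd_pow_mul_of_mem_pow (fun z hz => ?_) hz
    rw [hxy] at hz
    obtain ⟨α, β, rfl⟩ := Ideal.mem_span_pair.1 hz
    obtain ⟨w, hw⟩ := hr
    exact ⟨r * α + β * w, by linear_combination β * hw⟩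
  have key2 : ∀ x y r : D, y ∈ Ideal.span {a, b} → Ideal.span {a, b} = Ideal.span {x, y} →
      x ∣ r * y → e ∣ s * x ^ n → e ∣ r ^ n * (s * d) := by
    intro x y r hy hxy hr hes
    rw [← mul_assoc]
    refine Ideal.dvd_mul_of_mem_tcl (fun z hz => ?_) hdmem
    rw [mul_comm (r ^ n), mul_assoc]
    exact hes.trans (mul_dvd_mul_left s (key x y r hy hxy hr z hz))
  obtain ⟨r, hr, hab | hba⟩ := h.isLocallyValuation hM a b
  · exact ⟨r ^ n, fun h => hr (hM.isPrime.mem_of_pow_mem n h), key2 a b r hbI rfl hab hea⟩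
  · exact ⟨r ^ n, fun h => hr (hM.isPrime.mem_of_pow_mem n h), key2 b a r haI
      (by rw [Set.pair_comm]) hba heb⟩

end AlmostGCD

/-! ### Contractions of locally principal ideals -/

section LocalizedSpan

variable {D : Type*} [CommRing D]

/-- The contraction to `D` of the ideal generated by `a` in the localization at the prime `M`. -/
def localizedSpan (a : D) (M : Ideal D) (hM : M.IsPrime) : Ideal D where
  carrier := {y | ∃ s ∉ M, a ∣ s * y}
  zero_mem' := ⟨1, (Ideal.ne_top_iff_one M).1 hM.ne_top, by simp⟩
  add_mem' := by
    rintro x y ⟨s, hs, hx⟩ ⟨t, ht, hy⟩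
    refine ⟨s * t, hM.mul_notMem hs ht, ?_⟩
    rw [mul_add]
    refine dvd_add ?_ ?_
    · rw [mul_right_comm]; exact hx.mul_right t
    · rw [mul_assoc]; exact hy.mul_left s
  smul_mem' := by
    rintro c x ⟨s, hs, hx⟩
    refine ⟨s, hs, ?_⟩
    rw [smul_eq_mul, mul_left_comm]
    exact hx.mul_left c

theorem self_mem_localizedSpan (a : D) (M : Ideal D) (hM : M.IsPrime) :
    a ∈ localizedSpan a M hM := ⟨1, (Ideal.ne_top_iff_one M).1 hM.ne_top, by simp⟩

end LocalizedSpan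

/-! ### Independence of the localizations and factorization -/

section Independence

variable {D : Type*} [CommRing D] [IsDomain D] {K : Type*} [Field K] [Algebra D K]
  [IsFractionRing D K]

/-- A `t`-invertible `I` is nontrivial only at the finitely many `M` containing a fixed nonzero `x ∈
I`. There a power of a local generator `b M` factors as `c M * e M`, where `c M` collects the
valuation factors in `M`, which lie in no other maximal `t`-ideal, and `e M ∉ M`. The product of the
`c M` generates a power of `I` up to `t`-closure. -/
theorem IsWeaklyMatlis.isMulTorsion (hW : IsWeaklyMatlis D K)
    (hV : ∀ x : D, x ≠ 0 → IsAlmostVF K x) : IsMulTorsion (TClassGroup D K) := by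
  classical
  refine isMulTorsion_tClassGroup_of_forall_ideal fun I hI hinv => ?_
  obtain ⟨x, hxI, hx⟩ := Submodule.exists_mem_ne_zero_of_ne_bot hI
  set T := (hW.finite hx).toFinset with hT
  have hTmem : ∀ M, M ∈ T ↔ IsMaximalTIdeal K M ∧ x ∈ M := fun M => by simp [hT]
  choose! b hbI s hs hbs using (isTInvertible_coeIdeal_iff hI).1 hinv
  have hb0 : ∀ M, IsMaximalTIdeal K M → b M ≠ 0 := by
    intro M hM h0
    have := hbs M hM x hxI
    rw [h0, zero_dvd_iff] at this
    exact (mul_ne_zero (fun h => hs M hM (by rw [h]; exact M.zero_mem)) hx) this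
  obtain ⟨n, hn, h⟩ := T.exists_common_exponent (P := fun M n => ∃ c e, b M ^ n = c * e ∧ e ∉ M ∧
      ∀ N, IsMaximalTIdeal K N → N ≠ M → c ∉ N) (by
    rintro M hM n k - ⟨c, e, h1, h2, h3⟩
    have hMp := ((hTmem M).1 hM).1.isPrime
    refine ⟨c ^ k, e ^ k, by rw [pow_mul, h1, mul_pow], fun h => h2 (hMp.mem_of_pow_mem k h),
      fun N hN hNM h => h3 N hN hNM (hN.isPrime.mem_of_pow_mem k h)⟩) (by
    intro M hM
    have hM' := ((hTmem M).1 hM).1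
    have hMp := hM'.isPrime
    obtain ⟨n, hn, u, hu, S, hS, hbn⟩ := hV (b M) (hb0 M hM')
    refine ⟨n, hn, (S.filter (· ∈ M)).prod, u * (S.filter (· ∉ M)).prod, ?_, ?_, ?_⟩
    · rw [hbn, ← mul_left_comm, Multiset.prod_filter_mul_prod_filter_not]
    · refine hMp.mul_notMem (fun h => hM'.ne_top (Ideal.eq_top_of_isUnit_mem M h hu)) ?_
      rw [hMp.multiset_prod_mem_iff_exists_mem]
      rintro ⟨p, hp, hpM⟩
      exact (Multiset.mem_filter.1 hp).2 hpM
    · intro N hN hNM hc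
      have := hN.isPrime
      obtain ⟨p, hp, hpN⟩ := (this.multiset_prod_mem_iff_exists_mem _).1 hc
      obtain ⟨hpS, hpM⟩ := Multiset.mem_filter.1 hp
      exact hNM ((hS p hpS).eq_of_mem hN hM' hpN hpM))
  choose! c e hce he hcN using h
  have hc0 : ∀ M ∈ T, c M ≠ 0 := fun M hM h0 => pow_ne_zero n (hb0 M ((hTmem M).1 hM).1)
    (by rw [hce M hM, h0, zero_mul])
  refine ⟨n, hn, ∏ M ∈ T, c M, Finset.prod_ne_zero_iff.2 hc0, le_antisymm ?_ ?_⟩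
  · rw [← Ideal.tcl_span_singleton]
    refine Ideal.tcl_mono fun y hy => Ideal.mem_span_singleton.2 ?_
    refine prod_dvd_of_notMem_of_ne hc0 hcN fun M hM => ?_
    obtain ⟨hM', -⟩ := (hTmem M).1 hM
    refine dvd_of_notMem_of_ne (hc0 M hM) (hcN M hM)
      ⟨s M ^ n, fun h => hs M hM' (hM'.isPrime.mem_of_pow_mem n h), ?_⟩
    refine dvd_trans ?_ (Ideal.pow_dvd_pow_mul_of_mem_pow (hbs M hM') hy)
    rw [hce M hM]
    exact dvd_mul_right _ _
  · rw [Ideal.span_singleton_le_iff_mem]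
    refine mem_tcl_of_forall_isMaximalTIdeal K (pow_ne_zero n hI) fun N hN => ?_
    by_cases hNT : N ∈ T
    · refine ⟨e N, he N hNT, ?_⟩
      rw [← Finset.mul_prod_erase T c hNT, ← mul_assoc, mul_comm (e N), ← hce N hNT]
      exact Ideal.mul_mem_right _ _ (Ideal.pow_mem_pow (hbI N hN) n)
    · refine ⟨x ^ n, fun h => hNT ((hTmem N).2 ⟨hN, hN.isPrime.mem_of_pow_mem n h⟩),
        Ideal.mul_mem_right _ _ (Ideal.pow_mem_pow hxI n)⟩

/-- If `aD_M ∩ D ⊆ N`, then `aD` contains no product of elements outside `M` and outside `N`. A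
prime containing `a` and avoiding these products lies in `M ∩ N`; it is a `t`-ideal below two
maximal ones. -/
theorem IsWeaklyMatlis.not_localizedSpan_le (hW : IsWeaklyMatlis D K) {M N : Ideal D}
    (hM : IsMaximalTIdeal K M) (hN : IsMaximalTIdeal K N) (hMN : M ≠ N)
    (h : IsLocallyValuation M) {a : D} (ha : a ≠ 0) : ¬ localizedSpan a M hM.isPrime ≤ N := by
  intro hle
  have hMp := hM.isPrime
  have hNp := hN.isPrime
  obtain ⟨P, hP, haP, hdis⟩ := Ideal.exists_le_prime_disjoint (Ideal.span {a})
    (M.primeCompl ⊔ N.primeCompl) (Set.disjoint_left.2 fun y hy hy' => by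
      obtain ⟨s, hs, t, ht, rfl⟩ := Submonoid.mem_sup.1 hy'
      exact ht (hle ⟨s, hs, Ideal.mem_span_singleton.1 hy⟩))
  have hPM : P ≤ M := fun x hx => by
    by_contra hxM
    exact Set.disjoint_left.1 hdis hx (Submonoid.mem_sup_left (S := M.primeCompl) hxM)
  have hPN : P ≤ N := fun x hx => by
    by_contra hxN
    exact Set.disjoint_left.1 hdis hx (Submonoid.mem_sup_right (T := N.primeCompl) hxN)
  have hP0 : P ≠ ⊥ := by
    rintro rfl
    exact ha (by simpa using haP)
  exact hMN ((hW.2 P hP (isTIdeal_of_le_isLocallyValuation hP hP0 hPM hMp h)).unique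
    ⟨hM, hPM⟩ ⟨hN, hPN⟩)

/-- For each `M` containing `a`, prime avoidance gives `x ∈ aD_M ∩ D` outside the other maximal
`t`-ideals containing `a`. The gcd `d` of `a ^ n` and `x ^ n` agrees with `a ^ n` at `M` and is a
local unit elsewhere, so `a ^ n` is a unit times the product of these `d`. -/
theorem IsWeaklyMatlis.isAlmostVF (hW : IsWeaklyMatlis D K) (hA : IsAGCD D)
    (hL : ∀ M : Ideal D, IsMaximalTIdeal K M → IsLocallyValuation M) {a : D} (ha : a ≠ 0) :
    IsAlmostVF K a := by
  classical
  set T := (hW.finite ha).toFinset with hT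
  have hTmem : ∀ M, M ∈ T ↔ IsMaximalTIdeal K M ∧ a ∈ M := fun M => by simp [hT]
  obtain ⟨n, hn, h⟩ := T.exists_common_exponent (P := fun M n => ∃ d, d ∣ a ^ n ∧
      (∃ s ∉ M, a ^ n ∣ s * d) ∧ ∀ N, IsMaximalTIdeal K N → N ≠ M → d ∉ N) (by
    rintro M hM n k - ⟨d, h1, ⟨s, hs, h2⟩, h3⟩
    have hMp := ((hTmem M).1 hM).1.isPrime
    refine ⟨d ^ k, by rw [pow_mul]; exact pow_dvd_pow_of_dvd h1 k,
      ⟨s ^ k, fun h => hs (hMp.mem_of_pow_mem k h), ?_⟩,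
      fun N hN hNM h => h3 N hN hNM (hN.isPrime.mem_of_pow_mem k h)⟩
    rw [pow_mul, ← mul_pow]; exact pow_dvd_pow_of_dvd h2 k) (by
    intro M hM
    have hM' := ((hTmem M).1 hM).1
    obtain ⟨x, ⟨s, hs, hsx⟩, hx⟩ : ∃ x ∈ localizedSpan a M hM'.isPrime, ∀ N ∈ T.erase M, x ∉ N := by
      by_contra! hne
      have hsub : (localizedSpan a M hM'.isPrime : Set D) ⊆ ⋃ N ∈ (↑(T.erase M) : Set (Ideal D)),
          (id N : Ideal D) := by
        intro x hx
        obtain ⟨N, hN, hxN⟩ := hne x hx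
        exact Set.mem_biUnion hN hxN
      -- The two indices `⊥` that prime avoidance exempts from primality are dummies: all members
      -- are prime.
      obtain ⟨N, hN, hle⟩ := (Ideal.subset_union_prime (⊥ : Ideal D) ⊥ (fun N hN _ _ =>
        ((hTmem N).1 (Finset.mem_of_mem_erase hN)).1.isPrime)).1 hsub
      exact hW.not_localizedSpan_le hM' ((hTmem N).1 (Finset.mem_of_mem_erase hN)).1
        (Finset.ne_of_mem_erase hN).symm (hL M hM') ha hle
    obtain ⟨n, hn, d, hda, hdx, hd⟩ := isAGCD_iff.1 hA a x ha
    refine ⟨n, hn, d, hda, ⟨s ^ n, fun h => hs (hM'.isPrime.mem_of_pow_mem n h),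
      hd _ _ (dvd_mul_left _ _) (by rw [← mul_pow]; exact pow_dvd_pow_of_dvd hsx n)⟩, ?_⟩
    intro N hN hNM hdN
    have haN := hN.isPrime.mem_of_pow_mem n (N.mem_of_dvd hda hdN)
    have hxN := hN.isPrime.mem_of_pow_mem n (N.mem_of_dvd hdx hdN)
    exact hx N (Finset.mem_erase.2 ⟨hNM, (hTmem N).2 ⟨hN, haN⟩⟩) hxN)
  choose! d hda hd hdN using h
  have hd0 : ∀ M ∈ T, d M ≠ 0 := fun M hM h0 => pow_ne_zero n ha (by
    have := hda M hM
    rwa [h0, zero_dvd_iff] at this)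
  have h1 : ∏ M ∈ T, d M ∣ a ^ n := prod_dvd_of_notMem_of_ne hd0 hdN hda
  have h2 : a ^ n ∣ ∏ M ∈ T, d M := by
    refine dvd_of_forall_isMaximalTIdeal K (pow_ne_zero n ha) fun N hN => ?_
    by_cases hNT : N ∈ T
    · obtain ⟨s, hs, hsd⟩ := hd N hNT
      refine ⟨s, hs, ?_⟩
      rw [← Finset.mul_prod_erase T d hNT, ← mul_assoc]
      exact hsd.mul_right _
    · exact ⟨a ^ n, fun h => hNT ((hTmem N).2 ⟨hN, hN.isPrime.mem_of_pow_mem n h⟩),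
        dvd_mul_right _ _⟩
  obtain ⟨u, hu⟩ := associated_of_dvd_dvd h1 h2
  refine ⟨n, hn, u, u.isUnit, T.val.map d, ?_, by rw [← hu, mul_comm]; rfl⟩
  intro v hv
  obtain ⟨M, hM, rfl⟩ := Multiset.mem_map.1 hv
  obtain ⟨hM', haM⟩ := (hTmem M).1 hM
  refine isValuationElement_of_unique hM' (hL M hM') (hd0 M hM) (fun hu => ?_) (hdN M hM)
  obtain ⟨s, hs, hsd⟩ := hd M hM
  have h3 : s * d M ∈ M := M.mem_of_dvd hsd (M.pow_mem_of_mem haM n hn)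
  exact (hM'.isPrime.mem_or_mem h3).elim hs fun h =>
    hM'.ne_top (Ideal.eq_top_of_isUnit_mem M h hu)

/-- The factors of `aD` are the contractions `aD_M ∩ D` for `M` containing `a`. By independence each
becomes trivial at every other maximal `t`-ideal. -/
theorem IsWeaklyMatlis.isTVIFD (hW : IsWeaklyMatlis D K)
    (hL : ∀ M : Ideal D, IsMaximalTIdeal K M → IsLocallyValuation M) : IsTVIFD D K := by
  classical
  intro a ha
  -- A unit lies in no maximal `t`-ideal, but the factorization must be nonempty: `D` itself, with
  -- `V = K`, is used.
  by_cases hu : IsUnit a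
  · refine ⟨{⊤}, by simp, ?_, ?_⟩
    · intro I hI
      rw [Multiset.mem_singleton.1 hI]
      refine ⟨⊤, fun _ => ValuationSubring.mem_top _, fun d => iff_of_true
        (Submodule.subset_span ⟨d, trivial, rfl⟩) trivial⟩
    · rw [Multiset.prod_singleton, FractionalIdeal.coeIdeal_top, tClosure_one,
        Ideal.span_singleton_eq_top.2 hu, FractionalIdeal.coeIdeal_top]
  set T := (hW.finite ha).toFinset with hT
  have hTmem : ∀ M, M ∈ T ↔ IsMaximalTIdeal K M ∧ a ∈ M := fun M => by simp [hT]
  set J : T → Ideal D := fun M => localizedSpan a M.1 ((hTmem M.1).1 M.2).1.isPrime with hJ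
  have haJ : ∀ M, a ∈ J M := fun M => self_mem_localizedSpan _ _ _
  refine ⟨Finset.univ.val.map J, ?_, ?_, ?_⟩
  · obtain ⟨M, hM⟩ := exists_isMaximalTIdeal_mem K ha hu
    intro h
    have : J ⟨M, (hTmem M).2 hM⟩ ∈ Finset.univ.val.map J :=
      Multiset.mem_map_of_mem J (Finset.mem_univ _)
    rw [h] at this
    exact Multiset.notMem_zero _ this
  · intro I hI
    obtain ⟨M, -, rfl⟩ := Multiset.mem_map.1 hI
    have hM := ((hTmem M.1).1 M.2).1
    set V := valuationSubringAt K M.1 hM.isPrime (hL _ hM)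
    have ha' : algebraMap D K a ≠ 0 := by simpa using ha
    refine ⟨V, algebraMap_mem_valuationSubringAt _ _, fun d => ⟨fun hd => ?_, fun hd =>
      Submodule.subset_span ⟨d, hd, rfl⟩⟩⟩
    refine (div_mem_valuationSubringAt (K := K) (hM := hM.isPrime) (h := hL _ hM) ha).1 ?_
    have hle : Submodule.span V (algebraMap D K '' (J M : Set D)) ≤
        Submodule.span V {algebraMap D K a} := by
      refine Submodule.span_le.2 ?_
      rintro _ ⟨y, hy, rfl⟩
      have hyV : algebraMap D K y / algebraMap D K a ∈ V := (div_mem_valuationSubringAt ha).2 hy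
      exact Submodule.mem_span_singleton.2 ⟨⟨_, hyV⟩, div_mul_cancel₀ _ ha'⟩
    obtain ⟨v, hv⟩ := Submodule.mem_span_singleton.1 (hle hd)
    rw [← hv]
    change (v : K) * algebraMap D K a / _ ∈ V
    rw [mul_div_cancel_right₀ _ ha']
    exact v.2
  · rw [tClosure_coeIdeal, FractionalIdeal.coeIdeal_inj]
    change _ = (∏ M, J M).tcl
    have hcard : a ^ Fintype.card T ∈ ∏ M, J M := by
      rw [← Finset.card_univ, ← Finset.prod_const]
      exact Ideal.prod_mem_prod fun M _ => haJ M
    refine le_antisymm ?_ ?_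
    · rw [Ideal.span_singleton_le_iff_mem]
      refine mem_tcl_of_forall_isMaximalTIdeal K (fun h => pow_ne_zero _ ha (by
        rw [h] at hcard; exact hcard)) fun N hN => ?_
      by_cases hNT : N ∈ T
      · have : ∀ M : T, M.1 ≠ N → ∃ x ∈ J M, x ∉ N := fun M hMN => by
          have hM := ((hTmem M.1).1 M.2).1
          exact SetLike.not_le_iff_exists.1 (hW.not_localizedSpan_le hM hN hMN (hL _ hM) ha)
        choose! x hxJ hxN using this
        refine ⟨∏ M ∈ Finset.univ.erase ⟨N, hNT⟩, x M, hN.prod_notMem fun M hM =>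
          hxN M fun h => Finset.ne_of_mem_erase hM (Subtype.ext h), ?_⟩
        rw [← Finset.prod_erase_mul _ J (Finset.mem_univ ⟨N, hNT⟩)]
        exact Ideal.mul_mem_mul (Ideal.prod_mem_prod fun M hM =>
          hxJ M fun h => Finset.ne_of_mem_erase hM (Subtype.ext h)) (haJ _)
      · exact ⟨a ^ Fintype.card T, fun h => hNT ((hTmem N).2 ⟨hN, hN.isPrime.mem_of_pow_mem _ h⟩),
          Ideal.mul_mem_right _ _ hcard⟩
    · rw [← Ideal.tcl_span_singleton]
      refine Ideal.tcl_mono fun y hy => Ideal.mem_span_singleton.2 ?_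
      refine dvd_of_forall_isMaximalTIdeal K ha fun N hN => ?_
      by_cases hNT : N ∈ T
      · have hle : ∏ M, J M ≤ J ⟨N, hNT⟩ :=
          Ideal.prod_le_inf.trans (Finset.inf_le (Finset.mem_univ _))
        exact hle hy
      · exact ⟨a, fun h => hNT ((hTmem N).2 ⟨hN, h⟩), dvd_mul_right _ _⟩

/-- The valuation ring `V` of `I` also serves for `c`. Locally `I` is generated by some `i`, and `c`
agrees with `i ^ n` up to `s ^ n`, so it suffices to treat powers of `i`. -/
theorem isValuationAt_of_tcl_pow_eq_span {I : Ideal D}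
    (hI : IsTInvertible (I : FractionalIdeal D⁰ K)) (hv : IsValuationIdeal K I) {n : ℕ} {c : D}
    (hc : c ≠ 0) (h : (I ^ n).tcl = Ideal.span {c}) :
    ∃ V : ValuationSubring K, IsValuationAt V c := by
  obtain ⟨V, hV, hVI⟩ := hv
  refine ⟨V, hc, hV, fun y hy => ?_⟩
  have hI0 : I ≠ ⊥ := by
    rintro rfl
    exact hI.ne_zero (by simp)
  refine dvd_of_forall_isMaximalTIdeal K hc fun M hM => ?_
  obtain ⟨i, hi, s, hs, his⟩ := (isTInvertible_coeIdeal_iff hI0).1 hI M hM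
  have hi0 : i ≠ 0 := by
    rintro rfl
    refine hI0 ((Submodule.eq_bot_iff _).2 fun j hj => ?_)
    exact (mul_eq_zero.1 (zero_dvd_iff.1 (his j hj))).resolve_left fun h => hs (h ▸ M.zero_mem)
  have hi' : algebraMap D K i ≠ 0 := by simpa using hi0
  have hc' : algebraMap D K c ≠ 0 := by simpa using hc
  have hci : c ∣ i ^ n := by
    rw [← Ideal.mem_span_singleton, ← h]
    exact Ideal.le_tcl _ (Ideal.pow_mem_pow hi n)
  have hic : i ^ n ∣ s ^ n * c := by
    refine Ideal.dvd_mul_of_mem_tcl (fun z hz => Ideal.pow_dvd_pow_mul_of_mem_pow his hz)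
          (h ▸ Ideal.mem_span_singleton_self c)
  -- One factor `i` is split off at a time: `y / i ∈ V` puts `y` into `IV ∩ D = I`, so `s y = i w`,
  -- and `w / i ^ m = s y / i ^ (m + 1)` is again in `V`.
  have key : ∀ m : ℕ, ∀ y : D, algebraMap D K y / algebraMap D K i ^ m ∈ V → i ^ m ∣ s ^ m * y := by
    intro m
    induction m with
    | zero => simp
    | succ m ih =>
      intro y hy
      have hyI : y ∈ I := by
        refine (hVI y).1 ?_
        have h1 : algebraMap D K y / algebraMap D K i ∈ V := by
          convert V.mul_mem _ _ hy (hV (i ^ m)) using 1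
          rw [map_pow, pow_succ]
          field_simp
        have := Submodule.smul_mem (Submodule.span V (algebraMap D K '' (I : Set D)))
          (⟨_, h1⟩ : V) (Submodule.subset_span ⟨i, hi, rfl⟩)
        change algebraMap D K y / algebraMap D K i * algebraMap D K i ∈ _ at this
        rwa [div_mul_cancel₀ _ hi'] at this
      obtain ⟨w, hw⟩ := his y hyI
      have hw' : algebraMap D K s * algebraMap D K y = algebraMap D K i * algebraMap D K w := by
        rw [← map_mul, ← map_mul, hw]
      have := ih w (by
        convert V.mul_mem _ _ (hV s) hy using 1
        rw [pow_succ]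
        field_simp
        linear_combination -hw')
      rw [pow_succ, pow_succ, mul_assoc, hw, mul_left_comm, mul_comm (i ^ m)]
      exact mul_dvd_mul_left i this
  obtain ⟨w, hw⟩ := hic
  have hw' : algebraMap D K s ^ n * algebraMap D K c = algebraMap D K i ^ n * algebraMap D K w := by
    rw [← map_pow, ← map_mul, hw, map_mul, map_pow]
  refine ⟨s ^ n * s ^ n, fun h => hs (hM.isPrime.mem_of_pow_mem n
    ((hM.isPrime.mem_or_mem h).elim id id)), hci.trans ?_⟩
  rw [mul_assoc]
  refine key n _ ?_
  convert V.mul_mem _ _ hy (hV w) using 1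
  rw [map_mul, map_pow]
  field_simp
  linear_combination algebraMap D K y * hw'

/-- The factors of a principal ideal are `t`-invertible, so torsion gives each a power whose
`t`-closure is principal, generated by a unit or a valuation element. -/
theorem IsTVIFD.isAlmostVF (h : IsTVIFD D K) (ht : IsMulTorsion (TClassGroup D K)) {a : D}
    (ha : a ≠ 0) : IsAlmostVF K a := by
  obtain ⟨S, -, hS, haS⟩ := h a ha
  rw [tClosure_coeIdeal, FractionalIdeal.coeIdeal_inj] at haS
  have ha' : algebraMap D K a ≠ 0 := by simpa using ha
  have hSprod : tClosure ((S.prod : Ideal D) : FractionalIdeal D⁰ K) =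
      FractionalIdeal.spanSingleton D⁰ (algebraMap D K a) := by
    rw [tClosure_coeIdeal, ← haS, FractionalIdeal.coeIdeal_span_singleton]
  have hinv : ∀ I ∈ S, IsTInvertible (I : FractionalIdeal D⁰ K) := by
    intro I hI
    obtain ⟨R, rfl⟩ := Multiset.exists_cons_of_mem hI
    refine isTInvertible_of_mul (J := (R.prod : Ideal D) *
      FractionalIdeal.spanSingleton D⁰ (algebraMap D K a)⁻¹) ?_
    rw [← mul_assoc, ← FractionalIdeal.coeIdeal_mul, ← Multiset.prod_cons, ← tClosure_tClosure_mul,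
      hSprod, FractionalIdeal.spanSingleton_mul_spanSingleton, mul_inv_cancel₀ ha',
      FractionalIdeal.spanSingleton_one, tClosure_one]
  have key : ∀ R : Multiset (Ideal D), (∀ I ∈ R, IsValuationIdeal K I ∧
      IsTInvertible (I : FractionalIdeal D⁰ K)) →
      ∃ n, 0 < n ∧ ∃ d : D, IsAlmostVF K d ∧ (R.prod ^ n).tcl = Ideal.span {d} := by
    intro R
    induction R using Multiset.induction_on with
    | empty =>
      intro _
      exact ⟨1, one_pos, 1, isUnit_one.isAlmostVF, by
        rw [Multiset.prod_zero, one_pow, Ideal.one_eq_top, ← Ideal.span_singleton_one,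
          Ideal.tcl_span_singleton]⟩
    | cons I R ih =>
      intro hR
      obtain ⟨n, hn, d, hd, hnd⟩ := ih fun J hJ => hR J (Multiset.mem_cons_of_mem hJ)
      obtain ⟨hIv, hIi⟩ := hR I (Multiset.mem_cons_self I R)
      obtain ⟨m, hm, c, hc, hmc⟩ := exists_tcl_pow_eq_span ht hIi
      have hcV : IsAlmostVF K c := by
        by_cases hu : IsUnit c
        · exact hu.isAlmostVF
        · exact (isValuationElement_iff.2
            ⟨hu, isValuationAt_of_tcl_pow_eq_span hIi hIv hc hmc⟩).isAlmostVF
      refine ⟨m * n, Nat.mul_pos hm hn, c ^ n * d ^ m, (hcV.pow n).mul (hd.pow m), ?_⟩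
      rw [Multiset.prod_cons, mul_pow, pow_mul, mul_comm m n, pow_mul, ← Ideal.tcl_tcl_mul,
        ← Ideal.tcl_mul_tcl, ← Ideal.tcl_tcl_pow, hmc, ← Ideal.tcl_tcl_pow (R.prod ^ n), hnd,
        Ideal.span_singleton_pow, Ideal.span_singleton_pow, Ideal.tcl_span_singleton,
        Ideal.tcl_span_singleton, Ideal.span_singleton_mul_span_singleton,
        Ideal.tcl_span_singleton]
  obtain ⟨n, hn, d, hd, hnd⟩ := key S fun I hI => ⟨hS I hI, hinv I hI⟩
  rw [← Ideal.tcl_tcl_pow, ← haS, Ideal.span_singleton_pow, Ideal.tcl_span_singleton,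
    Ideal.span_singleton_eq_span_singleton] at hnd
  obtain ⟨u, hu⟩ := hnd.symm
  refine IsAlmostVF.of_pow hn ?_
  rw [← hu]
  exact hd.mul u.isUnit.isAlmostVF

end Independence

/-! ### Gauss extensions of valuations -/

section GaussValuation

variable {R : Type*} [CommRing R] {Γ : Type*} [LinearOrderedCommGroupWithZero Γ]

/-- The maximum of the values of the coefficients of a polynomial. -/
def Polynomial.gaussSup (v : Valuation R Γ) (p : R[X]) : Γ := p.support.sup fun i => v (p.coeff i)

theorem Polynomial.gaussSup_le_iff {v : Valuation R Γ} {p : R[X]} {γ : Γ} :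
    p.gaussSup v ≤ γ ↔ ∀ i, v (p.coeff i) ≤ γ := by
  rw [gaussSup, Finset.sup_le_iff]
  refine ⟨fun h i => ?_, fun h i _ => h i⟩
  by_cases hi : i ∈ p.support
  · exact h i hi
  · rw [notMem_support_iff.1 hi, map_zero]; exact zero_le

theorem Polynomial.le_gaussSup (v : Valuation R Γ) (p : R[X]) (i : ℕ) :
    v (p.coeff i) ≤ p.gaussSup v := gaussSup_le_iff.1 le_rfl i

theorem Polynomial.exists_gaussSup_eq (v : Valuation R Γ) (p : R[X]) :
    ∃ i, p.gaussSup v = v (p.coeff i) := by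
  rcases p.support.eq_empty_or_nonempty with h | h
  · refine ⟨0, ?_⟩
    rw [gaussSup, h, Finset.sup_empty, bot_eq_zero, support_eq_empty.1 h, coeff_zero, map_zero]
  · obtain ⟨i, -, hi⟩ := Finset.exists_mem_eq_sup p.support h fun i => v (p.coeff i)
    exact ⟨i, hi⟩

theorem Polynomial.exists_min_gaussSup_eq (v : Valuation R Γ) (p : R[X]) :
    ∃ i, p.gaussSup v = v (p.coeff i) ∧ ∀ k < i, v (p.coeff k) < p.gaussSup v := by
  classical
  have h := p.exists_gaussSup_eq v
  exact ⟨Nat.find h, Nat.find_spec h, fun k hk =>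
    lt_of_le_of_ne (p.le_gaussSup v k) fun h' => Nat.find_min h hk h'.symm⟩

theorem Polynomial.gaussSup_C (v : Valuation R Γ) (c : R) : (C c).gaussSup v = v c := by
  refine le_antisymm (gaussSup_le_iff.2 fun i => ?_) ?_
  · rw [coeff_C]
    split_ifs
    · exact le_rfl
    · rw [map_zero]; exact zero_le
  · simpa using (C c).le_gaussSup v 0

theorem Polynomial.gaussSup_mul (v : Valuation R Γ) (p q : R[X]) :
    (p * q).gaussSup v = p.gaussSup v * q.gaussSup v := by
  refine le_antisymm (gaussSup_le_iff.2 fun n => ?_) ?_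
  · rw [coeff_mul]
    refine v.map_sum_le fun ij _ => ?_
    rw [map_mul]
    exact mul_le_mul' (p.le_gaussSup v _) (q.le_gaussSup v _)
  · obtain ⟨i, hi, hi'⟩ := p.exists_min_gaussSup_eq v
    obtain ⟨j, hj, hj'⟩ := q.exists_min_gaussSup_eq v
    by_cases h0 : p.gaussSup v * q.gaussSup v = 0
    · rw [h0]; exact zero_le
    obtain ⟨hp0, hq0⟩ := mul_ne_zero_iff.1 h0
    have hp0' := zero_lt_iff.2 hp0
    have hq0' := zero_lt_iff.2 hq0
    have hmem : (i, j) ∈ Finset.HasAntidiagonal.antidiagonal (i + j) := by simp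
    have hval : v (p.coeff i * q.coeff j) = p.gaussSup v * q.gaussSup v := by
      rw [map_mul, ← hi, ← hj]
    have hlt : v (∑ x ∈ (Finset.HasAntidiagonal.antidiagonal (i + j)).erase (i, j),
          p.coeff x.1 * q.coeff x.2) <
        v (p.coeff i * q.coeff j) := by
      rw [hval]
      refine v.map_sum_lt h0 ?_
      rintro ⟨k, l⟩ hkl
      obtain ⟨hne, hkl⟩ := Finset.mem_erase.1 hkl
      rw [Finset.HasAntidiagonal.mem_antidiagonal] at hkl
      simp only at hkl ⊢
      rw [map_mul]
      rcases lt_trichotomy k i with hk | hk | hk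
      · calc v (p.coeff k) * v (q.coeff l) ≤ v (p.coeff k) * q.gaussSup v :=
              mul_le_mul_right (q.le_gaussSup v l) _
          _ < p.gaussSup v * q.gaussSup v := mul_lt_mul_of_pos_right (hi' k hk) hq0'
      · exact absurd (Prod.ext hk (by simp only; omega)) hne
      · calc v (p.coeff k) * v (q.coeff l) ≤ p.gaussSup v * v (q.coeff l) :=
              mul_le_mul_left (p.le_gaussSup v k) _
          _ < p.gaussSup v * q.gaussSup v := mul_lt_mul_of_pos_left (hj' l (by omega)) hp0'
    refine le_trans ?_ ((p * q).le_gaussSup v (i + j))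
    rw [coeff_mul, ← Finset.add_sum_erase _ _ hmem]
    exact (hval.symm.trans (v.map_add_eq_of_lt_left hlt).symm).le

/-- The Gauss extension of a valuation to the polynomial ring. -/
def gaussValuation (v : Valuation R Γ) : Valuation R[X] Γ where
  toFun p := p.gaussSup v
  map_zero' := by rw [← Polynomial.C_0, Polynomial.gaussSup_C, map_zero]
  map_one' := by rw [← Polynomial.C_1, Polynomial.gaussSup_C, map_one]
  map_mul' p q := Polynomial.gaussSup_mul v p q
  map_add_le_max' p q := Polynomial.gaussSup_le_iff.2 fun i => by
    rw [Polynomial.coeff_add]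
    exact (v.map_add _ _).trans (max_le_max (p.le_gaussSup v i) (q.le_gaussSup v i))

theorem gaussValuation_le_iff {v : Valuation R Γ} {p : R[X]} {γ : Γ} :
    gaussValuation v p ≤ γ ↔ ∀ i, v (p.coeff i) ≤ γ := Polynomial.gaussSup_le_iff

theorem gaussValuation_C (v : Valuation R Γ) (c : R) : gaussValuation v (Polynomial.C c) = v c :=
  Polynomial.gaussSup_C v c

theorem gaussValuation_ne_zero {F : Type*} [Field F] (v : Valuation F Γ) {p : F[X]} (hp : p ≠ 0) :
    gaussValuation v p ≠ 0 := by
  intro h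
  refine hp (Polynomial.ext fun i => ?_)
  have := gaussValuation_le_iff.1 h.le i
  simpa using this

variable [IsDomain R] {L : Type*} [Field L] [Algebra R L] [IsFractionRing R L]

theorem Valuation.exists_isValuationAt (w : Valuation R Γ) (h0 : ∀ r, w r = 0 → r = 0)
    (h1 : ∀ r, w r ≤ 1) {a : R} (ha : a ≠ 0) (h : ∀ y, w y ≤ w a → a ∣ y) :
    ∃ V : ValuationSubring L, IsValuationAt V a := by
  have hS : R⁰ ≤ w.supp.primeCompl := fun r hr hr' =>
    nonZeroDivisors.ne_zero hr (h0 r ((Valuation.mem_supp_iff _ _).1 hr'))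
  refine ⟨(w.extendToLocalization hS L).valuationSubring, ha, fun d => ?_, fun y hy => h y ?_⟩
  · rw [Valuation.mem_valuationSubring_iff, Valuation.extendToLocalization_apply_map_apply]
    exact h1 d
  · rw [Valuation.mem_valuationSubring_iff, map_div₀, Valuation.extendToLocalization_apply_map_apply,
      Valuation.extendToLocalization_apply_map_apply] at hy
    have ha0 : 0 < w a := zero_lt_iff.2 fun h => ha (h0 a h)
    rwa [div_le_one₀ ha0] at hy

end GaussValuation

/-! ### Valuation elements of the polynomial ring -/

section PolynomialRing

open Polynomial

variable {D : Type*} [CommRing D] {K : Type*} [Field K] [Algebra D K]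
  [IsFractionRing D K] {L : Type*} [Field L] [Algebra D[X] L] [IsFractionRing D[X] L]

variable (K) in
theorem IsValuationElement.of_C {a : D} (ha : IsValuationElement L (Polynomial.C a)) :
    IsValuationElement K a := by
  obtain ⟨hu, W, ha0, hW, h⟩ := isValuationElement_iff.1 ha
  have hinj : Function.Injective ((algebraMap D[X] L).comp (Polynomial.C : D →+* D[X])) :=
    (IsFractionRing.injective D[X] L).comp C_injective
  refine isValuationElement_iff.2 ⟨fun h => hu (h.map _),
    W.comap (IsFractionRing.lift (K := K) hinj), C_ne_zero.1 ha0, fun d => ?_, fun y hy => ?_⟩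
  · rw [ValuationSubring.mem_comap, IsFractionRing.lift_algebraMap]
    exact hW _
  · rw [ValuationSubring.mem_comap, map_div₀, IsFractionRing.lift_algebraMap,
      IsFractionRing.lift_algebraMap] at hy
    simpa using C_dvd_iff_dvd_coeff _ _ |>.1 (h _ hy) 0

variable [IsDomain D]

variable (L) in
-- The Gauss extension of `V` works, because divisibility by a constant is tested on coefficients.
theorem IsValuationElement.C {a : D} (ha : IsValuationElement K a) :
    IsValuationElement L (Polynomial.C a) := by
  obtain ⟨hu, V, ha0, hV, h⟩ := isValuationElement_iff.1 ha
  have ha' : algebraMap D K a ≠ 0 := by simpa using ha0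
  refine isValuationElement_iff.2 ⟨fun h => hu (isUnit_C.1 h), ?_⟩
  have hinj : Function.Injective (mapRingHom (algebraMap D K)) :=
    map_injective _ (IsFractionRing.injective D K)
  refine ((gaussValuation V.valuation).comap (mapRingHom (algebraMap D K))).exists_isValuationAt
    (fun r hr => ?_) (fun r => ?_) (C_ne_zero.2 ha0) (fun y hy => ?_)
  · by_contra hr0
    exact gaussValuation_ne_zero V.valuation ((map_ne_zero_iff _ hinj).2 hr0) hr
  · rw [Valuation.comap_apply, gaussValuation_le_iff]
    intro i
    rw [coe_mapRingHom, coeff_map, ValuationSubring.valuation_le_one_iff]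
    exact hV _
  · rw [C_dvd_iff_dvd_coeff]
    intro i
    rw [Valuation.comap_apply, Valuation.comap_apply, coe_mapRingHom, map_C, gaussValuation_C,
      gaussValuation_le_iff] at hy
    refine h _ ?_
    have := hy i
    rw [coeff_map] at this
    rw [← ValuationSubring.valuation_le_one_iff, map_div₀]
    exact (div_le_one₀ (zero_lt_iff.2 ((V.valuation.ne_zero_iff).2 ha'))).2 this

variable (L) in
theorem IsAlmostVF.C {a : D} (ha : IsAlmostVF K a) : IsAlmostVF L (Polynomial.C a) := by
  obtain ⟨n, hn, u, hu, s, hs, h⟩ := ha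
  refine ⟨n, hn, Polynomial.C u, hu.map _, s.map Polynomial.C, fun v hv => ?_, ?_⟩
  · obtain ⟨w, hw, rfl⟩ := Multiset.mem_map.1 hv
    exact (hs w hw).C L
  · rw [← C_pow, h, C_mul, ← Multiset.prod_hom s (Polynomial.C : D →+* D[X])]

variable (K) in
-- All factors of a nonzero constant are constants.
theorem IsAlmostVF.of_C {a : D} (ha0 : a ≠ 0) (ha : IsAlmostVF L (Polynomial.C a)) :
    IsAlmostVF K a := by
  obtain ⟨n, hn, u, hu, s, hs, h⟩ := ha
  obtain ⟨u, hu', rfl⟩ := Polynomial.isUnit_iff.1 hu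
  have hC : ∀ v ∈ s, Polynomial.C (v.coeff 0) = v := by
    intro v hv
    have hdvd : v ∣ Polynomial.C (a ^ n) := by
      rw [C_pow, h]; exact (Multiset.dvd_prod hv).mul_left _
    refine (eq_C_of_natDegree_eq_zero (Nat.le_zero.1 ?_)).symm
    exact (natDegree_le_of_dvd hdvd (C_ne_zero.2 (pow_ne_zero n ha0))).trans (natDegree_C _).le
  refine ⟨n, hn, u, hu', s.map fun v => v.coeff 0, fun v hv => ?_, C_injective ?_⟩
  · obtain ⟨w, hw, rfl⟩ := Multiset.mem_map.1 hv
    refine IsValuationElement.of_C K (L := L) ?_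
    rw [hC w hw]
    exact hs w hw
  · rw [C_pow, h, C_mul]
    congr 1
    rw [← Multiset.prod_hom _ (Polynomial.C : D →+* D[X]), Multiset.map_map]
    nth_rewrite 1 [← Multiset.map_id s]
    exact congrArg _ (Multiset.map_congr rfl fun v hv => (hC v hv).symm)

variable (K) in
/-- The Gauss valuation of `K[X]` attached to the localization of `D` at `M`. -/
def gaussValuationAt (M : Ideal D) (hM : M.IsPrime) (h : IsLocallyValuation M) :
    Valuation K[X] (valuationSubringAt K M hM h).ValueGroup :=
  gaussValuation (valuationSubringAt K M hM h).valuation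

theorem valuation_valuationSubringAt_le_iff {M : Ideal D} {hM : M.IsPrime}
    {h : IsLocallyValuation M} {a y : D} (ha : a ≠ 0) :
    (valuationSubringAt K M hM h).valuation (algebraMap D K y) ≤
      (valuationSubringAt K M hM h).valuation (algebraMap D K a) ↔ ∃ s ∉ M, a ∣ s * y := by
  have ha' : algebraMap D K a ≠ 0 := by simpa using ha
  rw [← div_mem_valuationSubringAt (K := K) (hM := hM) (h := h) ha,
    ← ValuationSubring.valuation_le_one_iff, map_div₀,
    div_le_one₀ (zero_lt_iff.2 ((Valuation.ne_zero_iff _).2 ha'))]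

variable (K) in
/-- A polynomial of Gauss value `1` at all maximal `t`-ideals. -/
def IsTPrimitive (hL : ∀ M : Ideal D, IsMaximalTIdeal K M → IsLocallyValuation M) (q : D[X]) :
    Prop :=
  ∀ M hM, gaussValuationAt K M hM.isPrime (hL M hM) (q.map (algebraMap D K)) = 1

variable {hL : ∀ M : Ideal D, IsMaximalTIdeal K M → IsLocallyValuation M}

theorem IsTPrimitive.mul {p q : D[X]} (hp : IsTPrimitive K hL p) (hq : IsTPrimitive K hL q) :
    IsTPrimitive K hL (p * q) := fun M hM => by
  rw [Polynomial.map_mul, map_mul, hp M hM, hq M hM, one_mul]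

theorem isTPrimitive_one : IsTPrimitive K hL 1 := fun M hM => by rw [Polynomial.map_one, map_one]

theorem IsTPrimitive.pow {p : D[X]} (hp : IsTPrimitive K hL p) (n : ℕ) :
    IsTPrimitive K hL (p ^ n) := fun M hM => by
  rw [Polynomial.map_pow, map_pow, hp M hM, one_pow]

theorem gaussValuationAt_map_le_one {M : Ideal D} {hM : M.IsPrime} {h : IsLocallyValuation M}
    (f : D[X]) : gaussValuationAt K M hM h (f.map (algebraMap D K)) ≤ 1 := by
  rw [gaussValuationAt, gaussValuation_le_iff]
  intro i
  rw [coeff_map, ValuationSubring.valuation_le_one_iff]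
  exact algebraMap_mem_valuationSubringAt _ _ _

/-- Holds coefficientwise, `D` being the intersection of its localizations at maximal `t`-ideals. -/
theorem exists_map_eq_of_gaussValuationAt_le_one {h : K[X]}
    (hh : ∀ M hM, gaussValuationAt K M hM.isPrime (hL M hM) h ≤ 1) :
    ∃ f : D[X], f.map (algebraMap D K) = h := by
  have : h ∈ lifts (algebraMap D K) := by
    rw [lifts_iff_coeff_lifts]
    intro i
    obtain ⟨a, b, hb, hab⟩ := IsFractionRing.div_surjective (A := D) (h.coeff i)
    have hb0 := nonZeroDivisors.ne_zero hb
    have hdvd : b ∣ a := dvd_of_forall_isMaximalTIdeal K hb0 fun M hM => by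
      have := gaussValuation_le_iff.1 (hh M hM) i
      rw [ValuationSubring.valuation_le_one_iff, ← hab] at this
      exact (div_mem_valuationSubringAt hb0).1 this
    obtain ⟨c, rfl⟩ := hdvd
    exact ⟨c, by rw [← hab, map_mul, mul_div_cancel_left₀ _ (by simpa using hb0)]⟩
  obtain ⟨f, hf⟩ := (mem_lifts _).1 this
  exact ⟨f, hf⟩

theorem IsTPrimitive.dvd_of_map_dvd {q f : D[X]} (hq : IsTPrimitive K hL q)
    (h : q.map (algebraMap D K) ∣ f.map (algebraMap D K)) : q ∣ f := by
  obtain ⟨g, hg⟩ := h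
  obtain ⟨g, rfl⟩ := exists_map_eq_of_gaussValuationAt_le_one (hL := hL) (h := g) fun M hM => by
    have := congrArg (gaussValuationAt K M hM.isPrime (hL M hM)) hg
    rw [map_mul, hq M hM, one_mul] at this
    rw [← this]
    exact gaussValuationAt_map_le_one f
  exact ⟨g, map_injective _ (IsFractionRing.injective D K) (by rw [hg, Polynomial.map_mul])⟩

variable (hL) in
-- The content ideal `I` of `f` is `t`-invertible and torsion gives `(I ^ n)_t = dD`. At every `M`
-- the Gauss value of `f ^ n` is then that of `d`, so `f ^ n / d` has coefficients in `D` and value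
-- one.
theorem exists_pow_eq_C_mul_isTPrimitive (ht : IsMulTorsion (TClassGroup D K)) {f : D[X]}
    (hf : f ≠ 0) : ∃ n, 0 < n ∧ ∃ d : D, d ≠ 0 ∧ ∃ q, IsTPrimitive K hL q ∧
      f ^ n = Polynomial.C d * q := by
  classical
  set F : Finset D := f.support.image f.coeff with hF
  set I : Ideal D := Ideal.span (F : Set D) with hI
  have hcoeff : ∀ i, f.coeff i ∈ I := by
    intro i
    by_cases hi : i ∈ f.support
    · exact Ideal.subset_span (Finset.mem_coe.2 (Finset.mem_image_of_mem _ hi))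
    · rw [notMem_support_iff.1 hi]; exact I.zero_mem
  have hI0 : I ≠ ⊥ := by
    intro h
    refine hf (Polynomial.ext fun i => ?_)
    have := hcoeff i
    rw [h] at this
    simpa using this
  have hinv := isPvMD_of_isLocallyValuation hL I hI0 ⟨F, rfl⟩
  obtain ⟨n, hn, d, hd, hnd⟩ := exists_tcl_pow_eq_span ht hinv
  have hd' : algebraMap D K d ≠ 0 := by simpa using hd
  have key : ∀ M hM, gaussValuationAt K M hM.isPrime (hL M hM) ((f ^ n).map (algebraMap D K)) =
      (valuationSubringAt K M hM.isPrime (hL M hM)).valuation (algebraMap D K d) := by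
    intro M hM
    obtain ⟨i, hi, s, hs, his⟩ := (isTInvertible_coeIdeal_iff hI0).1 hinv M hM
    have hi0 : i ≠ 0 := by
      rintro rfl
      refine hI0 ((Submodule.eq_bot_iff _).2 fun j hj => ?_)
      exact (mul_eq_zero.1 (zero_dvd_iff.1 (his j hj))).resolve_left fun h => hs (h ▸ M.zero_mem)
    set v := (valuationSubringAt K M hM.isPrime (hL M hM)).valuation with hv
    have hvd : v (algebraMap D K d) = v (algebraMap D K i) ^ n := by
      rw [← map_pow, ← map_pow]
      refine le_antisymm ((valuation_valuationSubringAt_le_iff (pow_ne_zero n hi0)).2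
        ⟨s ^ n, fun h => hs (hM.isPrime.mem_of_pow_mem n h), ?_⟩)
        ((valuation_valuationSubringAt_le_iff hd).2
          ⟨1, (Ideal.ne_top_iff_one M).1 hM.ne_top, ?_⟩)
      · refine Ideal.dvd_mul_of_mem_tcl (fun z hz => Ideal.pow_dvd_pow_mul_of_mem_pow his hz)
          (hnd ▸ Ideal.mem_span_singleton_self d)
      · rw [one_mul, ← Ideal.mem_span_singleton, ← hnd]
        exact Ideal.le_tcl _ (Ideal.pow_mem_pow hi n)
    rw [Polynomial.map_pow, map_pow, hvd]
    congr 1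
    refine le_antisymm (gaussValuation_le_iff.2 fun j => ?_) ?_
    · rw [coeff_map]
      exact (valuation_valuationSubringAt_le_iff hi0).2 ⟨s, hs, his _ (hcoeff j)⟩
    · have hle : ∀ z ∈ I, v (algebraMap D K z) ≤
          gaussValuationAt K M hM.isPrime (hL M hM) (f.map (algebraMap D K)) := by
        intro z hz
        induction hz using Submodule.span_induction with
        | mem x hx =>
          obtain ⟨j, -, rfl⟩ := Finset.mem_image.1 (Finset.mem_coe.1 hx)
          rw [← coeff_map]
          exact gaussValuation_le_iff.1 le_rfl j
        | zero => rw [map_zero, map_zero]; exact zero_le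
        | add x y _ _ hx hy =>
          rw [map_add]; exact (v.map_add _ _).trans (max_le hx hy)
        | smul c x _ hx =>
          rw [smul_eq_mul, map_mul, map_mul]
          refine (mul_le_mul' ?_ hx).trans (one_mul _).le
          rw [hv, ValuationSubring.valuation_le_one_iff]
          exact algebraMap_mem_valuationSubringAt _ _ _
      exact hle i hi
  obtain ⟨q, hq⟩ := exists_map_eq_of_gaussValuationAt_le_one (hL := hL)
    (h := Polynomial.C (algebraMap D K d)⁻¹ * (f ^ n).map (algebraMap D K)) fun M hM => by
      rw [map_mul, key M hM, gaussValuationAt, gaussValuation_C, map_inv₀, inv_mul_cancel₀]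
      exact (Valuation.ne_zero_iff _).2 hd'
  refine ⟨n, hn, d, hd, q, fun M hM => ?_, map_injective _ (IsFractionRing.injective D K) ?_⟩
  · rw [hq, map_mul, key M hM, gaussValuationAt, gaussValuation_C, map_inv₀, inv_mul_cancel₀]
    exact (Valuation.ne_zero_iff _).2 hd'
  · rw [Polynomial.map_mul, hq, map_C, ← mul_assoc, ← C_mul, mul_inv_cancel₀ hd', C_1, one_mul]

variable (L) in
-- Over `K[X]` divisibility by `q` is divisibility by `p ^ m`, which the `p`-adic valuation detects;
-- the Gauss lemma `IsTPrimitive.dvd_of_map_dvd` descends it to `D[X]`.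
theorem IsTPrimitive.isValuationElement {q : D[X]} (hq : IsTPrimitive K hL q) {p : K[X]}
    (hp : Irreducible p) {c : K} (hc : c ≠ 0) {m : ℕ} (hm : 0 < m)
    (h : q.map (algebraMap D K) = Polynomial.C c * p ^ m) : IsValuationElement L q := by
  have hinj : Function.Injective (mapRingHom (algebraMap D K)) :=
    map_injective _ (IsFractionRing.injective D K)
  have hCu : IsUnit (Polynomial.C c) := isUnit_C.2 hc.isUnit
  have hq0 : q ≠ 0 := by
    rintro rfl
    rw [Polynomial.map_zero] at h
    exact mul_ne_zero hCu.ne_zero (pow_ne_zero m hp.ne_zero) h.symm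
  refine isValuationElement_iff.2 ⟨fun hu => ?_, ?_⟩
  · have h1 : IsUnit (q.map (algebraMap D K)) := hu.map (mapRingHom (algebraMap D K))
    rw [h] at h1
    exact hp.not_isUnit ((isUnit_pow_iff hm.ne').1 (isUnit_of_mul_isUnit_right h1))
  · let P : IsDedekindDomain.HeightOneSpectrum K[X] :=
      ⟨Ideal.span {p}, (Ideal.span_singleton_prime hp.ne_zero).2 hp.prime,
        by simpa using hp.ne_zero⟩
    refine (P.intValuation.comap (mapRingHom (algebraMap D K))).exists_isValuationAt
      (fun r hr => ?_) (fun r => P.intValuation_le_one _) hq0 (fun y hy => ?_)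
    · by_contra hr0
      exact P.intValuation_ne_zero _ ((map_ne_zero_iff _ hinj).2 hr0) hr
    · refine hq.dvd_of_map_dvd ?_
      rw [h, hCu.mul_left_dvd, ← Ideal.mem_span_singleton, ← Ideal.span_singleton_pow]
      refine (P.intValuation_le_pow_iff_mem _ m).1 (hy.trans ?_)
      rw [Valuation.comap_apply, P.intValuation_le_pow_iff_mem, coe_mapRingHom, h]
      exact Ideal.mul_mem_left _ _ (Ideal.pow_mem_pow (Ideal.mem_span_singleton_self p) m)

variable (L hL) in
theorem exists_pow_eq_C_mul_isAlmostVF (ht : IsMulTorsion (TClassGroup D K)) {f : K[X]}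
    (hf : f ≠ 0) : ∃ n, 0 < n ∧ ∃ c : K, c ≠ 0 ∧ ∃ q : D[X], IsTPrimitive K hL q ∧
      IsAlmostVF L q ∧ f ^ n = Polynomial.C c * q.map (algebraMap D K) := by
  induction f using WfDvdMonoid.induction_on_irreducible with
  | zero => exact absurd rfl hf
  | unit u hu =>
    obtain ⟨c, hc, rfl⟩ := Polynomial.isUnit_iff.1 hu
    exact ⟨1, one_pos, c, hc.ne_zero, 1, isTPrimitive_one, isUnit_one.isAlmostVF, by simp⟩
  | mul g p hg hp ih =>
    obtain ⟨n, hn, c, hc, q, hq, hqV, hgn⟩ := ih hg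
    obtain ⟨b, hb, hbp⟩ := IsLocalization.integerNormalization_spec D⁰ p
    set r := IsLocalization.integerNormalization D⁰ p
    have hb' : algebraMap D K b ≠ 0 := by simpa using nonZeroDivisors.ne_zero hb
    have hrp : r.map (algebraMap D K) = Polynomial.C (algebraMap D K b) * p := by
      rw [hbp, ← smul_eq_C_mul, algebraMap_smul]
    have hr0 : r ≠ 0 := by
      intro h
      rw [h, Polynomial.map_zero] at hrp
      exact mul_ne_zero (C_ne_zero.2 hb') hp.ne_zero hrp.symm
    obtain ⟨m, hm, d, hd, s, hs, hrs⟩ := exists_pow_eq_C_mul_isTPrimitive hL ht hr0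
    have hd' : algebraMap D K d ≠ 0 := by simpa using hd
    have hsp : Polynomial.C (algebraMap D K b) ^ m * p ^ m =
        Polynomial.C (algebraMap D K d) * s.map (algebraMap D K) := by
      rw [← mul_pow, ← hrp, ← Polynomial.map_pow, hrs, Polynomial.map_mul, map_C]
    have hsV : IsValuationElement L s := hs.isValuationElement L hp
      (c := (algebraMap D K d)⁻¹ * algebraMap D K b ^ m)
      (mul_ne_zero (inv_ne_zero hd') (pow_ne_zero m hb')) hm (by
        rw [C_mul, C_pow, mul_assoc, hsp, ← mul_assoc, ← C_mul, inv_mul_cancel₀ hd', C_1, one_mul])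
    have hpm : p ^ m = Polynomial.C ((algebraMap D K b ^ m)⁻¹ * algebraMap D K d) *
        s.map (algebraMap D K) := by
      rw [C_mul, mul_assoc, ← hsp, ← C_pow, ← mul_assoc, ← C_mul,
        inv_mul_cancel₀ (pow_ne_zero m hb'), C_1, one_mul]
    refine ⟨m * n, Nat.mul_pos hm hn, ((algebraMap D K b ^ m)⁻¹ * algebraMap D K d) ^ n * c ^ m,
      mul_ne_zero (pow_ne_zero n (mul_ne_zero (inv_ne_zero (pow_ne_zero m hb')) hd'))
        (pow_ne_zero m hc), s ^ n * q ^ m, (hs.pow n).mul (hq.pow m),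
      (hsV.isAlmostVF.pow n).mul (hqV.pow m), ?_⟩
    rw [mul_pow, pow_mul, hpm, mul_comm m n, pow_mul, hgn, Polynomial.map_mul, Polynomial.map_pow,
      Polynomial.map_pow]
    simp only [C_mul, C_pow]
    ring

theorem isAVFD_polynomial (hL : ∀ M : Ideal D, IsMaximalTIdeal K M → IsLocallyValuation M)
    (ht : IsMulTorsion (TClassGroup D K)) (hV : IsAVFD D K) : IsAVFD D[X] L := by
  rw [isAVFD_iff] at hV ⊢
  intro f hf
  have hf' : f.map (algebraMap D K) ≠ 0 := by
    rwa [Ne, Polynomial.map_eq_zero_iff (IsFractionRing.injective D K)]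
  obtain ⟨n, hn, c, hc, q, hq, hqV, hfn⟩ := exists_pow_eq_C_mul_isAlmostVF L hL ht hf'
  rw [← Polynomial.map_pow] at hfn
  -- Since `q` has Gauss value one everywhere, the constant `c` has the value of `f ^ n`, which is
  -- at most one; hence `c ∈ D`.
  obtain ⟨g, hg⟩ := exists_map_eq_of_gaussValuationAt_le_one (hL := hL)
    (h := Polynomial.C c) fun M hM => by
      have := congrArg (gaussValuationAt K M hM.isPrime (hL M hM)) hfn
      rw [map_mul, hq M hM, mul_one] at this
      rw [← this]
      exact gaussValuationAt_map_le_one _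
  have hgd : algebraMap D K (g.coeff 0) = c := by
    rw [← coeff_map, hg, coeff_C_zero]
  have hd0 : g.coeff 0 ≠ 0 := by
    intro h
    rw [h, map_zero] at hgd
    exact hc hgd.symm
  refine IsAlmostVF.of_pow hn ?_
  have : f ^ n = Polynomial.C (g.coeff 0) * q :=
    map_injective _ (IsFractionRing.injective D K) (by
      rw [hfn, Polynomial.map_mul, map_C, hgd])
  rw [this]
  exact ((hV _ hd0).C L).mul hqV

theorem IsAVFD.of_polynomial (h : IsAVFD D[X] L) : IsAVFD D K := by
  rw [isAVFD_iff] at h ⊢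
  exact fun a ha => (h _ (C_ne_zero.2 ha)).of_C K ha

end PolynomialRing

end

/-! ### The equivalences -/

theorem corollary5p6 (D : Type*) [CommRing D] [IsDomain D]
    (K : Type*) [Field K] [Algebra D K] [IsFractionRing D K]
    (L : Type*) [Field L] [Algebra D[X] L] [IsFractionRing D[X] L]
    (hD : IsTTreed D K) :
    List.TFAE [
      IsAVFD D K,
      IsIntegrallyClosed D ∧ IsWeaklyMatlis D K ∧ IsAGCD D,
      IsIndependentKrullType D K ∧ IsMulTorsion (TClassGroup D K),
      IsMulTorsion (TClassGroup D K) ∧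
        ∀ P : Ideal D, P.IsPrime → P ≠ ⊥ → ∃ a ∈ P, IsValuationElement K a,
      IsTVIFD D K ∧ IsMulTorsion (TClassGroup D K),
      IsAVFD D[X] L] := by
  have hprime : IsAVFD D K → ∀ P : Ideal D, P.IsPrime → P ≠ ⊥ →
      ∃ a ∈ P, IsValuationElement K a := by
    intro h P hP hP0
    obtain ⟨x, hxP, hx⟩ := Submodule.exists_mem_ne_zero_of_ne_bot hP0
    obtain ⟨n, hn, s, hs, hxn⟩ :=
      h x hx fun hu => hP.ne_top (Ideal.eq_top_of_isUnit_mem P hxP hu)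
    have hsP : s.prod ∈ P := hxn ▸ P.pow_mem_of_mem hxP n hn
    obtain ⟨v, hv, hvP⟩ := (hP.multiset_prod_mem_iff_exists_mem s).1 hsP
    exact ⟨v, hvP, hs v hv⟩
  have h14 : IsAVFD D K → IsMulTorsion (TClassGroup D K) ∧
      ∀ P : Ideal D, P.IsPrime → P ≠ ⊥ → ∃ a ∈ P, IsValuationElement K a := fun h =>
    ⟨(isWeaklyMatlis_of_forall_exists_isValuationElement (hprime h)).isMulTorsion
      (isAVFD_iff.1 h), hprime h⟩
  tfae_have 1 → 4 := h14
  tfae_have 4 → 3 := fun ⟨ht, h⟩ => ⟨⟨isWeaklyMatlis_of_forall_exists_isValuationElement h,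
    isPvMD_of_isLocallyValuation fun _ hM =>
      isLocallyValuation_of_forall_exists_isValuationElement hD h hM⟩, ht⟩
  tfae_have 3 → 2 := fun ⟨⟨hW, hP⟩, ht⟩ =>
    ⟨isIntegrallyClosed_of_isLocallyValuation (K := K) fun _ hM => hP.isLocallyValuation hM, hW,
      isAGCD_of_isPvMD_of_isMulTorsion hP ht⟩
  tfae_have 2 → 1 := fun ⟨_, hW, hA⟩ => isAVFD_iff.2 fun _ hx =>
    hW.isAlmostVF hA (fun _ hM => hA.isLocallyValuation hM) hx
  tfae_have 3 → 5 := fun ⟨⟨hW, hP⟩, ht⟩ => ⟨hW.isTVIFD fun _ hM => hP.isLocallyValuation hM, ht⟩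
  tfae_have 5 → 1 := fun ⟨h, ht⟩ => isAVFD_iff.2 fun _ hx => h.isAlmostVF ht hx
  tfae_have 1 → 6 := fun h => isAVFD_polynomial
    (fun _ hM => isLocallyValuation_of_forall_exists_isValuationElement hD (hprime h) hM)
    (h14 h).1 h
  tfae_have 6 → 1 := IsAVFD.of_polynomial
  tfae_finish
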